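/- Let $d\ge 1$, let $\beta>0$, and let $f:\mathbb{R}^d\to[0,\infty)$ be a bounded probability density that is Riemann integrable on $\mathbb{R}^d$ in the following sense: with $Q_{k,\delta}=\prod_{l=1}^d[\delta k_l,\delta(k_l+1))$, the upper sums $U(\delta)=\sum_{k\in\mathbb{Z}^d}\delta^d\sup_{Q_{k,\delta}}f$ are finite for every $\delta>0$, and $U(\delta)-\sum_{k\in\mathbb{Z}^d}\delta^d\inf_{Q_{k,\delta}}f\to 0$ as $\delta\downarrow 0$. For $\lambda,h>0$ and a box $\Lambda=\{i\in\mathbb{Z}^d: a_l\le i_l\le b_l \text{ for all } l\}$ consider the Ising model on $\{-1,1\}^\Lambda$ with Hamiltonian $$H(\sigma)=-\frac12\sum_{i,j\in\Lambda}J_{ij}\sigma_i\sigma_j-h\sum_{i\in\Lambda}\sigma_i,\qquad J_{ij}=\beta\lambda^d f(\lambda(i-j)),$$ and let $m_{\Lambda,i}=\sum_\sigma\sigma_i e^{-H(\sigma)}/\sum_\sigma e^{-H(\sigma)}$. Put $J^{s}_{ij}=\frac12(J_{ij}+J_{ji})$, so that $J^s=J$ if $f$ is even. Then there is a constant $C<\infty$,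 depending only on $d$, $f$ and $\beta$, such that for all $\lambda>0$ and $h>0$ the following hold. 1. For every box $\Lambda$ and every $i\in\Lambda$, $$\Big|m_{\Lambda,i}-\tanh\Big(h+\sum_{j\in\Lambda}J^{s}_{ij}m_{\Lambda,j}\Big)\Big|\le C\,\frac{\lambda^d(1+|\log h|)}{h},$$ and if $h>1$ the left-hand side is also at most $C\,\dfrac{\lambda^d}{h\log h}$. 2. There is a number $m=m(\lambda,h)$ such that $m_{\Lambda,i}\to m$ as $\Lambda\to\mathbb{Z}^d$ through boxes, for every fixed $i\in\mathbb{Z}^d$. 3. The series $\sum_{i\in\mathbb{Z}^d}\lambda^d f(\lambda i)$ converges, and $$\Big|m-\tanh\Big(h+\beta m\sum_{i\in\mathbb{Z}^d}\lambda^d f(\lambda i)\Big)\Big|\le C\,\frac{\lambda^d(1+|\log h|)}{h},$$ and if $h>1$ the left-hand side is also at most $C\,\dfrac{\lambda^d}{h\log h}$. Moreover, for every $h>0$ the limit $m_0=\lim_{\lambda\downarrow0}m(\lambda,h)$ exists and satisfies $m_0=\tanh(h+\beta m_0)$. -/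

import Mathlib

open Filter Topology MeasureTheory
open scoped ENNReal

noncomputable section

namespace KacIsing

section FiniteModel

variable {ι : Type*} [Fintype ι] [DecidableEq ι]

/-- The value `±1` of the spin at the site `i`; configurations are functions to `ℤˣ = {1, -1}`. -/
def spin (σ : ι → ℤˣ) (i : ι) : ℝ := ((σ i : ℤ) : ℝ)

/-- The Hamiltonian `H(σ) = -(1/2) ∑_{i,j} J_{ij} σ_i σ_j - ∑_i h_i σ_i`. -/
def hamiltonian (J : ι → ι → ℝ) (h : ι → ℝ) (σ : ι → ℤˣ) : ℝ :=
  -(1 / 2) * ∑ i, ∑ j, J i j * spin σ i * spin σ j - ∑ i, h i * spin σ i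

/-- The partition function `Z = ∑_σ exp (-H(σ))`. -/
def partitionFunction (J : ι → ι → ℝ) (h : ι → ℝ) : ℝ :=
  ∑ σ : ι → ℤˣ, Real.exp (-hamiltonian J h σ)

/-- The Gibbs expectation of an observable. -/
def gibbsMean (J : ι → ι → ℝ) (h : ι → ℝ) (F : (ι → ℤˣ) → ℝ) : ℝ :=
  (∑ σ : ι → ℤˣ, F σ * Real.exp (-hamiltonian J h σ)) / partitionFunction J h

/-- The magnetization at the site `i`. -/
def magnetization (J : ι → ι → ℝ) (h : ι → ℝ) (i : ι) : ℝ :=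
  gibbsMean J h (fun σ => spin σ i)

end FiniteModel

/-- The lattice point `i ∈ ℤ^d`, scaled by `lam`, as a point of `ℝ^d`. -/
def scaledPoint {d : ℕ} (lam : ℝ) (i : Fin d → ℤ) : Fin d → ℝ := fun k => lam * (i k : ℝ)

/-- The Kac coupling `J_{ij} = β λ^d f(λ (i - j))`. -/
def kacCoupling {d : ℕ} (f : (Fin d → ℝ) → ℝ) (β lam : ℝ) (i j : Fin d → ℤ) : ℝ :=
  β * lam ^ d * f (scaledPoint lam (i - j))

/-- The magnetization at `i ∈ Λ` of the Kac model in the finite set `Λ ⊂ ℤ^d` with constant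
external field `h` (and `0`, by convention, at sites outside of `Λ`). -/
def kacMagnetization {d : ℕ} (f : (Fin d → ℝ) → ℝ) (β lam h : ℝ) (Λ : Finset (Fin d → ℤ))
    (i : Fin d → ℤ) : ℝ :=
  if hi : i ∈ Λ then
    magnetization (ι := Λ) (fun j k => kacCoupling f β lam j.1 k.1) (fun _ => h) ⟨i, hi⟩
  else 0

/-- The half-open cube `∏_l [δ k_l, δ (k_l + 1))`. -/
def cell {d : ℕ} (δ : ℝ) (k : Fin d → ℤ) : Set (Fin d → ℝ) :=
  {x | ∀ l, δ * (k l : ℝ) ≤ x l ∧ x l < δ * ((k l : ℝ) + 1)}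

/-- The upper Riemann sum of a non-negative function over the grid of cubes of side `δ`. -/
def upperSum {d : ℕ} (f : (Fin d → ℝ) → ℝ) (δ : ℝ) : ℝ≥0∞ :=
  ∑' k : Fin d → ℤ, ENNReal.ofReal (δ ^ d) * ⨆ x ∈ cell δ k, ENNReal.ofReal (f x)

/-- The lower Riemann sum of a non-negative function over the grid of cubes of side `δ`. -/
def lowerSum {d : ℕ} (f : (Fin d → ℝ) → ℝ) (δ : ℝ) : ℝ≥0∞ :=
  ∑' k : Fin d → ℤ, ENNReal.ofReal (δ ^ d) * ⨅ x ∈ cell δ k, ENNReal.ofReal (f x)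

/-- Riemann integrability on the whole of `ℝ^d` of a non-negative function ("direct" Riemann
integrability): the upper Riemann sums over all of `ℝ^d` are finite, and the difference between
upper and lower sums vanishes as the mesh tends to zero. -/
def RiemannIntegrable {d : ℕ} (f : (Fin d → ℝ) → ℝ) : Prop :=
  (∀ δ : ℝ, 0 < δ → upperSum f δ ≠ ∞) ∧
    Tendsto (fun δ : ℝ => upperSum f δ - lowerSum f δ) (𝓝[>] 0) (𝓝 0)

end KacIsing

end

/-! Conditioning on all spins except the one at i gives m_i = ⟨tanh(h + φ_i)⟩, where φ_i is the
field the other spins exert on i (`magnetization_eq_gibbsMean_tanh`). In a second-order expansion of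
tanh about the mean of φ_i the linear term averages to zero, so the error is controlled by the
variance of φ_i, that is ∑_{j,k} J_ij J_ik cov(σ_j, σ_k) with symmetrized couplings. One coupling is
O(λ^d) and the other has bounded row sums, so a bound on ∑_k cov(σ_j, σ_k) suffices. The covariances
are non-negative by Griffiths' inequality, and their sum is the derivative of m_j in h, at most 2/h
because m_j is bounded by 1 and concave in h ≥ 0 (Griffiths-Hurst-Sherman).

Both correlation inequalities come from independent copies of the system: in rotated coordinates the
observable and the total exponent are polynomials with non-negative coefficients, and all
single-site moments are non-negative.

For small λ every argument of tanh is at least h - O(1), so the error carries a factor e^{-2h}. For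
λ bounded away from 0, both sides of the equation lie in [tanh h, 1]. Together this gives C λ^d
e^{-2h}(1 + 1/h), which implies both stated bounds.

Magnetizations increase with the volume, so they converge, and dominated convergence passes the
equation to the limit. As λ → 0 the Riemann sums tend to ∫ f = 1; compactness and uniqueness of the
non-negative Curie-Weiss solution give m₀. -/

namespace KacIsing

open scoped NNReal

/-! ### Positivity of sums over configurations, and single-site moments of rotated spins. -/

section PositiveCone

variable {ι A S : Type*}

/-- The cone of polynomials with non-negative coefficients in the single-site functions
`e a (ω i)`. -/
noncomputable def posCone (ι : Type*) (e : A → S → ℝ) : Subalgebra ℝ≥0 ((ι → S) → ℝ) :=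
  Algebra.adjoin ℝ≥0 (Set.range fun (p : ι × A) (ω : ι → S) => e p.2 (ω p.1))

theorem coord_mem_posCone (e : A → S → ℝ) (i : ι) (a : A) :
    (fun ω : ι → S => e a (ω i)) ∈ posCone ι e :=
  Algebra.subset_adjoin ⟨(i, a), rfl⟩

theorem const_mul_mem_posCone {e : A → S → ℝ} {F : (ι → S) → ℝ} (hF : F ∈ posCone ι e) {c : ℝ}
    (hc : 0 ≤ c) : (fun ω => c * F ω) ∈ posCone ι e := by
  have h := (posCone ι e).smul_mem hF ⟨c, hc⟩
  exact h

theorem sum_mem_posCone {e : A → S → ℝ} {κ : Type*} (s : Finset κ) {F : κ → (ι → S) → ℝ}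
    (hF : ∀ k ∈ s, F k ∈ posCone ι e) : (fun ω => ∑ k ∈ s, F k ω) ∈ posCone ι e := by
  have h := (posCone ι e).sum_mem hF
  convert h using 1
  ext ω
  simp

/-- By linearity a monomial suffices, and its sum over configurations factorizes into a product over
sites of the single-site moments in `he`. -/
theorem sum_nonneg_of_mem_posCone [Fintype ι] [DecidableEq ι] [Fintype A] [Fintype S]
    {e : A → S → ℝ} (he : ∀ n : A → ℕ, 0 ≤ ∑ s, ∏ a, e a s ^ n a) {F : (ι → S) → ℝ}
    (hF : F ∈ posCone ι e) : 0 ≤ ∑ ω, F ω := by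
  rw [posCone, Algebra.adjoin_range_eq_range_aeval] at hF
  obtain ⟨P, rfl⟩ := hF
  change 0 ≤ ∑ ω, MvPolynomial.aeval (R := ℝ≥0)
    (fun (p : ι × A) (ω : ι → S) => e p.2 (ω p.1)) P ω
  induction P using MvPolynomial.induction_on' with
  | add P Q hP hQ =>
    simp only [map_add, Pi.add_apply, Finset.sum_add_distrib]
    exact add_nonneg hP hQ
  | monomial m c =>
    have key : ∀ ω : ι → S, (MvPolynomial.aeval (R := ℝ≥0)
        (fun (p : ι × A) (ω : ι → S) => e p.2 (ω p.1)) (MvPolynomial.monomial m c)) ω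
        = (c : ℝ) * ∏ i, ∏ a, e a (ω i) ^ m (i, a) := by
      intro ω
      rw [MvPolynomial.aeval_monomial, Finsupp.prod_fintype _ _ (fun _ => pow_zero _),
        Fintype.prod_prod_type]
      simp only [Pi.mul_apply, Finset.prod_apply, Pi.pow_apply]
      rfl
    simp only [key, ← Finset.mul_sum]
    refine mul_nonneg c.2 ?_
    have h2 := Finset.prod_univ_sum (fun _ : ι => (Finset.univ : Finset S))
      (fun i s => ∏ a, e a s ^ m (i, a))
    rw [Fintype.piFinset_univ] at h2
    rw [← h2]
    exact Finset.prod_nonneg fun i _ => he fun a => m (i, a)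

/-- In the power series of the exponential, every term F * G ^ n stays in the cone. -/
theorem sum_mul_exp_nonneg [Fintype ι] [DecidableEq ι] [Fintype A] [Fintype S]
    {e : A → S → ℝ} (he : ∀ n : A → ℕ, 0 ≤ ∑ s, ∏ a, e a s ^ n a) {F G : (ι → S) → ℝ}
    (hF : F ∈ posCone ι e) (hG : G ∈ posCone ι e) : 0 ≤ ∑ ω, F ω * Real.exp (G ω) := by
  have h1 : HasSum (fun n : ℕ => ∑ ω, F ω * (G ω ^ n / (n.factorial : ℝ)))
      (∑ ω, F ω * Real.exp (G ω)) := by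
    refine hasSum_sum fun ω _ => HasSum.mul_left _ ?_
    rw [Real.exp_eq_exp_ℝ]
    exact NormedSpace.expSeries_div_hasSum_exp (G ω)
  refine h1.nonneg fun n => ?_
  have h2 : ∀ ω, F ω * (G ω ^ n / (n.factorial : ℝ)) = (n.factorial : ℝ)⁻¹ * (F * G ^ n) ω := by
    intro ω
    simp only [Pi.mul_apply, Pi.pow_apply]
    ring
  simp only [h2]
  exact sum_nonneg_of_mem_posCone he (const_mul_mem_posCone
    ((posCone ι e).mul_mem hF ((posCone ι e).pow_mem hG n)) (by positivity))

end PositiveCone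

/-- The sum and the difference of two spins. -/
def pairCoord (a : Fin 2) (s : Fin 2 → ℤˣ) : ℝ :=
  ![((s 0 : ℤ) : ℝ) + ((s 1 : ℤ) : ℝ), ((s 0 : ℤ) : ℝ) - ((s 1 : ℤ) : ℝ)] a

/-- The Ellis-Monroe rotation of four spins. -/
def quadCoord (a : Fin 4) (s : Fin 4 → ℤˣ) : ℝ :=
  ![((s 0 : ℤ) : ℝ) + ((s 1 : ℤ) : ℝ) + ((s 2 : ℤ) : ℝ) + ((s 3 : ℤ) : ℝ),
    ((s 0 : ℤ) : ℝ) + ((s 1 : ℤ) : ℝ) - ((s 2 : ℤ) : ℝ) - ((s 3 : ℤ) : ℝ),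
    ((s 0 : ℤ) : ℝ) - ((s 1 : ℤ) : ℝ) + ((s 2 : ℤ) : ℝ) - ((s 3 : ℤ) : ℝ),
    -((s 0 : ℤ) : ℝ) + ((s 1 : ℤ) : ℝ) + ((s 2 : ℤ) : ℝ) - ((s 3 : ℤ) : ℝ)] a

theorem sum_fin_succ_fun {n : ℕ} (F : (Fin (n + 1) → ℤˣ) → ℝ) :
    ∑ s, F s = (∑ s : Fin n → ℤˣ, F (Matrix.vecCons 1 s)) + ∑ s : Fin n → ℤˣ, F (Matrix.vecCons (-1) s) := by
  rw [← (Fin.consEquiv fun _ : Fin (n + 1) => ℤˣ).sum_comp, Fintype.sum_prod_type]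
  have : (Finset.univ : Finset ℤˣ) = {1, -1} := by decide
  rw [this, Finset.sum_pair (by decide)]
  rfl

theorem sum_fin_zero_fun (F : (Fin 0 → ℤˣ) → ℝ) : ∑ s, F s = F ![] := by
  rw [Fintype.sum_unique]
  congr 1

theorem pairCoord_moments (n : Fin 2 → ℕ) : 0 ≤ ∑ s, ∏ a, pairCoord a s ^ n a := by
  simp only [sum_fin_succ_fun, Fin.prod_univ_two, pairCoord, sum_fin_zero_fun]
  simp
  norm_num
  rcases Nat.even_or_odd (n 0) with h0 | h0 <;> rcases Nat.even_or_odd (n 1) with h1 | h1 <;>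
    simp only [h0.neg_pow, h1.neg_pow] <;> ring_nf <;> positivity

/-- An even number of minus spins gives ±4 times a unit vector; an odd number gives a vector with
entries ±2 and an even number of minus signs. Opposite signs in the last row of the rotation would
make that number odd and the all-odd moments negative. -/
theorem quadCoord_moments (n : Fin 4 → ℕ) : 0 ≤ ∑ s, ∏ a, quadCoord a s ^ n a := by
  simp only [sum_fin_succ_fun, Fin.prod_univ_four, quadCoord, sum_fin_zero_fun]
  simp
  norm_num
  rcases Nat.even_or_odd (n 0) with h0 | h0 <;> rcases Nat.even_or_odd (n 1) with h1 | h1 <;>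
    rcases Nat.even_or_odd (n 2) with h2 | h2 <;> rcases Nat.even_or_odd (n 3) with h3 | h3 <;>
    simp only [h0.neg_pow, h1.neg_pow, h2.neg_pow, h3.neg_pow] <;> ring_nf <;> positivity

/-! ### Estimates for tanh and the Curie-Weiss equation. -/

section Tanh

theorem hasDerivAt_tanh (x : ℝ) : HasDerivAt Real.tanh (1 - Real.tanh x ^ 2) x := by
  have h := (Real.hasDerivAt_sinh x).div (Real.hasDerivAt_cosh x) (Real.cosh_pos x).ne'
  have e1 : Real.tanh = Real.sinh / Real.cosh := by
    ext y; exact Real.tanh_eq_sinh_div_cosh y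
  rw [e1]
  refine h.congr_deriv ?_
  have := (Real.cosh_pos x).ne'
  rw [Pi.div_apply]
  field_simp

theorem monotone_tanh : Monotone Real.tanh :=
  monotone_of_hasDerivAt_nonneg (f' := fun x => 1 - Real.tanh x ^ 2) hasDerivAt_tanh
    fun x => sub_nonneg.2 (Real.tanh_sq_lt_one x).le

theorem continuous_tanh : Continuous Real.tanh :=
  continuous_iff_continuousAt.2 fun x => (hasDerivAt_tanh x).continuousAt

theorem tanh_nonneg {x : ℝ} (hx : 0 ≤ x) : 0 ≤ Real.tanh x := by
  simpa using monotone_tanh hx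

theorem tanh_pos {x : ℝ} (hx : 0 < x) : 0 < Real.tanh x := by
  rw [Real.tanh_eq_sinh_div_cosh]
  exact div_pos (Real.sinh_pos_iff.2 hx) (Real.cosh_pos x)

theorem one_sub_tanh_le (x : ℝ) : 1 - Real.tanh x ≤ 2 * Real.exp (-(2 * x)) := by
  have h1 := Real.exp_pos x
  have h2 := Real.exp_pos (-x)
  have h3 : Real.exp (-(2 * x)) * Real.exp x = Real.exp (-x) := by
    rw [← Real.exp_add]; congr 1; ring
  rw [Real.tanh_eq, one_sub_div (by positivity), div_le_iff₀ (by positivity)]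
  nlinarith [Real.exp_pos (-(2 * x))]

theorem one_sub_tanh_sq_le {c x : ℝ} (h : c ≤ x) :
    1 - Real.tanh x ^ 2 ≤ 4 * Real.exp (-(2 * c)) := by
  have h1 := one_sub_tanh_le x
  have h2 : Real.exp (-(2 * x)) ≤ Real.exp (-(2 * c)) := Real.exp_le_exp.2 (by linarith)
  have h3 := Real.tanh_lt_one x
  nlinarith [Real.neg_one_lt_tanh x]

theorem abs_tanh_sub_tanh_le {c x y : ℝ} (hx : c ≤ x) (hy : c ≤ y) :
    |Real.tanh y - Real.tanh x| ≤ 4 * Real.exp (-(2 * c)) * |y - x| := by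
  refine (convex_Ici c).norm_image_sub_le_of_norm_hasDerivWithin_le
    (fun z _ => (hasDerivAt_tanh z).hasDerivWithinAt) (fun z hz => ?_) hx hy
  rw [Real.norm_eq_abs, abs_of_nonneg (sub_nonneg.2 (Real.tanh_sq_lt_one z).le)]
  exact one_sub_tanh_sq_le hz

/-- The mean value inequality is applied to tanh minus its linear part at x; the lower bound c
supplies the exponential decay. -/
theorem abs_tanh_taylor_le {c x y : ℝ} (hx : c ≤ x) (hy : c ≤ y) :
    |Real.tanh y - Real.tanh x - (1 - Real.tanh x ^ 2) * (y - x)|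
      ≤ 8 * Real.exp (-(2 * c)) * (y - x) ^ 2 := by
  have h := (convex_uIcc x y).norm_image_sub_le_of_norm_hasDerivWithin_le
    (f := fun z => Real.tanh z - (1 - Real.tanh x ^ 2) * z)
    (f' := fun z => (1 - Real.tanh z ^ 2) - (1 - Real.tanh x ^ 2) * 1)
    (C := 8 * Real.exp (-(2 * c)) * |y - x|)
    (fun z _ => ((hasDerivAt_tanh z).sub ((hasDerivAt_id z).const_mul _)).hasDerivWithinAt)
    (fun z hz => ?_) Set.left_mem_uIcc Set.right_mem_uIcc
  · simp only [Real.norm_eq_abs] at h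
    calc _ = |Real.tanh y - (1 - Real.tanh x ^ 2) * y
          - (Real.tanh x - (1 - Real.tanh x ^ 2) * x)| := by congr 1; ring
      _ ≤ _ := h
      _ = _ := by rw [mul_assoc, ← sq, sq_abs]
  · have hcz : c ≤ z := by
      rcases Set.mem_uIcc.1 hz with h | h <;> linarith [h.1]
    have hzx : |z - x| ≤ |y - x| := by
      exact Set.abs_sub_left_of_mem_uIcc hz
    have e1 : (1 - Real.tanh z ^ 2) - (1 - Real.tanh x ^ 2) * 1
        = -((Real.tanh z - Real.tanh x) * (Real.tanh z + Real.tanh x)) := by ring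
    have h1 := abs_tanh_sub_tanh_le hx hcz
    have h2 : |Real.tanh z + Real.tanh x| ≤ 2 :=
      (abs_add_le _ _).trans (by linarith [Real.abs_tanh_lt_one z, Real.abs_tanh_lt_one x])
    rw [e1, Real.norm_eq_abs, abs_neg, abs_mul]
    calc _ ≤ (4 * Real.exp (-(2 * c)) * |z - x|) * 2 := by gcongr
      _ ≤ (4 * Real.exp (-(2 * c)) * |y - x|) * 2 := by gcongr
      _ = _ := by ring

theorem concaveOn_tanh : ConcaveOn ℝ (Set.Ici 0) Real.tanh := by
  have hd : deriv Real.tanh = fun x => 1 - Real.tanh x ^ 2 :=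
    funext fun x => (hasDerivAt_tanh x).deriv
  refine AntitoneOn.concaveOn_of_deriv (convex_Ici 0) continuous_tanh.continuousOn
    (fun x _ => (hasDerivAt_tanh x).differentiableAt.differentiableWithinAt) ?_
  rw [hd, interior_Ici]
  intro x hx y _ hxy
  have h0 := tanh_nonneg (le_of_lt hx)
  have h1 := monotone_tanh hxy
  simp only
  nlinarith

/-- Uniqueness of the non-negative solution of the Curie-Weiss equation in a positive field. -/
theorem curieWeiss_unique {β h x y : ℝ} (hβ : 0 < β) (hh : 0 < h) (hx : 0 ≤ x)
    (ex : x = Real.tanh (h + β * x)) (ey : y = Real.tanh (h + β * y)) (hxy : x < y) : False := by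
  have hy : 0 < y := hx.trans_lt hxy
  have h0 := tanh_pos hh
  -- The point h + βx lies between h and h + βy with weight x / y, so concavity gives x ≥ (1 - x/y)
  -- tanh h + x, which is impossible since tanh h > 0.
  have hc := concaveOn_tanh.2 (Set.mem_Ici.2 hh.le) (y := h + β * y)
    (by have := mul_pos hβ hy; simp only [Set.mem_Ici]; linarith)
    (sub_nonneg.2 ((div_le_one hy).2 hxy.le)) (div_nonneg hx hy.le) (by ring)
  simp only [smul_eq_mul] at hc
  have e1 : (1 - x / y) * h + x / y * (h + β * y) = h + β * x := by field_simp; ring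
  rw [e1, ← ex, ← ey, div_mul_cancel₀ _ hy.ne'] at hc
  have : 0 < (1 - x / y) * Real.tanh h := mul_pos (sub_pos.2 ((div_lt_one hy).2 hxy)) h0
  linarith

end Tanh

/-- Convergence of approximate solutions of the Curie-Weiss equation. -/
theorem tendsto_curieWeiss {α : Type*} {l : Filter α} [l.NeBot] {β h : ℝ} (hβ : 0 < β)
    (hh : 0 < h) {m s : α → ℝ} (hm : ∀ᶠ a in l, m a ∈ Set.Icc (0 : ℝ) 1)
    (hs : Tendsto s l (𝓝 1))
    (hlim : Tendsto (fun a => m a - Real.tanh (h + β * m a * s a)) l (𝓝 0)) :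
    ∃ m₀ : ℝ, Tendsto m l (𝓝 m₀) ∧ m₀ = Real.tanh (h + β * m₀) := by
  -- Every cluster point solves the limiting equation; convergence then follows from compactness of
  -- [0, 1] and uniqueness.
  have sol : ∀ x, MapClusterPt x l m → x = Real.tanh (h + β * x) := by
    intro x hx
    obtain ⟨U, hU, hUx⟩ := mapClusterPt_iff_ultrafilter.1 hx
    have h1 := hUx.sub ((continuous_tanh.tendsto _).comp
      (((hUx.const_mul β).mul (hs.mono_left hU)).const_add h))
    have h2 := tendsto_nhds_unique h1 (hlim.mono_left hU)
    rw [mul_one] at h2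
    linarith
  have mem : ∀ x, MapClusterPt x l m → 0 ≤ x := by
    intro x hx
    obtain ⟨U, hU, hUx⟩ := mapClusterPt_iff_ultrafilter.1 hx
    exact ge_of_tendsto hUx ((hm.filter_mono hU).mono fun a ha => ha.1)
  obtain ⟨m₀, -, hm₀⟩ := isCompact_Icc.exists_mapClusterPt (f := l) (u := m)
    (le_principal_iff.2 hm)
  refine ⟨m₀, isCompact_Icc.tendsto_nhds_of_unique_mapClusterPt hm fun x _ hx => ?_, sol _ hm₀⟩
  rcases lt_trichotomy x m₀ with hlt | heq | hlt
  · exact (curieWeiss_unique hβ hh (mem _ hx) (sol _ hx) (sol _ hm₀) hlt).elim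
  · exact heq
  · exact (curieWeiss_unique hβ hh (mem _ hm₀) (sol _ hm₀) (sol _ hx) hlt).elim

/-! ### Griffiths and GHS inequalities through independent copies. -/

section Gibbs

variable {ι : Type*} [Fintype ι] [DecidableEq ι]

theorem partitionFunction_pos (J : ι → ι → ℝ) (h : ι → ℝ) : 0 < partitionFunction J h :=
  Finset.sum_pos (fun _ _ => Real.exp_pos _) Finset.univ_nonempty

omit [DecidableEq ι] in
theorem neg_hamiltonian (J : ι → ι → ℝ) (h : ι → ℝ) (σ : ι → ℤˣ) :
    -hamiltonian J h σ =
      (∑ i, ∑ j, 1 / 2 * J i j * (spin σ i * spin σ j)) + ∑ i, h i * spin σ i := by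
  simp only [hamiltonian, mul_assoc, ← Finset.mul_sum]
  ring

omit [DecidableEq ι] in
theorem sum_neg_hamiltonian {n : ℕ} (J : Fin n → ι → ι → ℝ) (h : Fin n → ι → ℝ)
    (ω : ι → Fin n → ℤˣ) :
    ∑ c, -hamiltonian (J c) (h c) (fun i => ω i c) =
      (∑ i, ∑ k, ∑ c, 1 / 2 * J c i k * (spin (ω i) c * spin (ω k) c))
        + ∑ i, ∑ c, h c i * spin (ω i) c := by
  simp only [neg_hamiltonian, Finset.sum_add_distrib]
  congr 1
  · rw [Finset.sum_comm]
    refine Finset.sum_congr rfl fun i _ => Finset.sum_comm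
  · exact Finset.sum_comm

theorem sum_prod_copies {n : ℕ} (F : Fin n → (ι → ℤˣ) → ℝ) :
    ∑ ω : ι → Fin n → ℤˣ, ∏ c, F c (fun i => ω i c) = ∏ c, ∑ σ, F c σ := by
  rw [Finset.prod_univ_sum, Fintype.piFinset_univ]
  exact (Equiv.piComm fun (_ : ι) (_ : Fin n) => ℤˣ).sum_comp fun p => ∏ c, F c (p c)

theorem sum_spin_mul_exp_copies {n : ℕ} (J : Fin n → ι → ι → ℝ) (h : Fin n → ι → ℝ) (c : Fin n)
    (j : ι) :
    ∑ ω : ι → Fin n → ℤˣ, spin (fun i => ω i c) j *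
        Real.exp (∑ c', -hamiltonian (J c') (h c') fun i => ω i c')
      = magnetization (J c) (h c) j * ∏ c', partitionFunction (J c') (h c') := by
  have h1 := sum_prod_copies fun c' (σ : ι → ℤˣ) =>
    (if c' = c then spin σ j else 1) * Real.exp (-hamiltonian (J c') (h c') σ)
  have h2 : ∀ c', ∑ σ : ι → ℤˣ,
      (if c' = c then spin σ j else 1) * Real.exp (-hamiltonian (J c') (h c') σ)
      = (if c' = c then magnetization (J c') (h c') j else 1)
        * partitionFunction (J c') (h c') := by
    intro c'
    split_ifs
    · rw [magnetization, gibbsMean, div_mul_cancel₀ _ (partitionFunction_pos _ _).ne']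
    · simp [partitionFunction]
  simp only [h2, Finset.prod_mul_distrib, ← Real.exp_sum, Finset.prod_ite_eq', Finset.mem_univ,
    if_true] at h1
  exact h1

/-- By independence of the copies, the unnormalized sum is the combination of magnetizations times
the product of all partition functions, which is positive. -/
theorem sum_magnetization_nonneg {n : ℕ} {J : Fin n → ι → ι → ℝ} {h : Fin n → ι → ℝ}
    {ε : Fin n → ℝ} {j : ι}
    (H : 0 ≤ ∑ ω : ι → Fin n → ℤˣ, (∑ c, ε c * spin (fun i => ω i c) j) *
      Real.exp (∑ c, -hamiltonian (J c) (h c) fun i => ω i c)) :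
    0 ≤ ∑ c, ε c * magnetization (J c) (h c) j := by
  have h1 : ∑ ω : ι → Fin n → ℤˣ, (∑ c, ε c * spin (fun i => ω i c) j) *
      Real.exp (∑ c, -hamiltonian (J c) (h c) fun i => ω i c)
      = (∑ c, ε c * magnetization (J c) (h c) j) * ∏ c, partitionFunction (J c) (h c) := by
    simp only [Finset.sum_mul, mul_assoc, ← sum_spin_mul_exp_copies]
    rw [Finset.sum_comm]
    simp only [Finset.mul_sum]
  rw [h1] at H
  exact nonneg_of_mul_nonneg_left H (Finset.prod_pos fun c _ => partitionFunction_pos _ _)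

/-- Griffiths' monotonicity of the magnetization in the couplings and in the fields. -/
theorem magnetization_mono {J₁ J₂ : ι → ι → ℝ} {h₁ h₂ : ι → ℝ} (hJ₁ : ∀ i j, 0 ≤ J₁ i j)
    (hJ : ∀ i j, J₁ i j ≤ J₂ i j) (hh₁ : ∀ i, 0 ≤ h₁ i) (hh : ∀ i, h₁ i ≤ h₂ i) (j : ι) :
    magnetization J₁ h₁ j ≤ magnetization J₂ h₂ j := by
  have key := sum_magnetization_nonneg (J := ![J₂, J₁]) (h := ![h₂, h₁]) (ε := ![1, -1]) (j := j) ?_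
  · simp at key
    linarith
  have hF := coord_mem_posCone (ι := ι) pairCoord j 1
  -- The total exponent in sum and difference coordinates: only sums and differences of the two sets
  -- of couplings and fields appear, all non-negative.
  have hG : (fun ω : ι → Fin 2 → ℤˣ =>
      (∑ i, ∑ k, ((J₂ i k + J₁ i k) / 8 * (pairCoord 0 (ω i) * pairCoord 0 (ω k)
          + pairCoord 1 (ω i) * pairCoord 1 (ω k))
        + (J₂ i k - J₁ i k) / 8 * (pairCoord 0 (ω i) * pairCoord 1 (ω k)
          + pairCoord 1 (ω i) * pairCoord 0 (ω k))))
      + ∑ i, ((h₂ i + h₁ i) / 2 * pairCoord 0 (ω i) + (h₂ i - h₁ i) / 2 * pairCoord 1 (ω i)))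
      ∈ posCone ι pairCoord := by
    have m := fun i a => coord_mem_posCone (ι := ι) pairCoord i a
    refine add_mem (sum_mem_posCone _ fun i _ => sum_mem_posCone _ fun k _ => add_mem
      (const_mul_mem_posCone (add_mem (mul_mem (m i 0) (m k 0)) (mul_mem (m i 1) (m k 1))) ?_)
      (const_mul_mem_posCone (add_mem (mul_mem (m i 0) (m k 1)) (mul_mem (m i 1) (m k 0))) ?_))
      (sum_mem_posCone _ fun i _ => add_mem (const_mul_mem_posCone (m i 0) ?_)
        (const_mul_mem_posCone (m i 1) ?_))
    · linarith [hJ₁ i k, hJ i k]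
    · linarith [hJ i k]
    · linarith [hh₁ i, hh i]
    · linarith [hh i]
  refine (sum_mul_exp_nonneg pairCoord_moments hF hG).trans_eq (Finset.sum_congr rfl fun ω _ => ?_)
  rw [sum_neg_hamiltonian]
  congr 1
  · simp [Fin.sum_univ_two, pairCoord, spin]
    ring
  · congr 2
    · refine Finset.sum_congr rfl fun i _ => Finset.sum_congr rfl fun k _ => ?_
      simp [Fin.sum_univ_two, pairCoord, spin]
      ring
    · refine Finset.sum_congr rfl fun i _ => ?_
      simp [Fin.sum_univ_two, pairCoord, spin]
      ring

/-- Midpoint concavity of the magnetization in the field (Griffiths-Hurst-Sherman). -/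
theorem magnetization_midpoint {J : ι → ι → ℝ} (hJ : ∀ i j, 0 ≤ J i j) {h s : ℝ} (hh : 0 ≤ h)
    (hs : 0 ≤ s) (j : ι) :
    magnetization J (fun _ => h + s) j + magnetization J (fun _ => h - s) j
      ≤ 2 * magnetization J (fun _ => h) j := by
  have key := sum_magnetization_nonneg (J := fun _ : Fin 4 => J)
    (h := ![fun _ => h, fun _ => h, fun _ => h + s, fun _ => h - s])
    (ε := ![1, 1, -1, -1]) (j := j) ?_
  · simp [Fin.sum_univ_four] at key
    linarith
  have hF := coord_mem_posCone (ι := ι) quadCoord j 1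
  -- All copies share J, so orthogonality of the rotation keeps the interaction diagonal. The fields
  -- h, h, h + s, h - s have rotated coefficients h, 0, s/2, s/2, so h - s itself may be negative.
  have hG : (fun ω : ι → Fin 4 → ℤˣ =>
      (∑ i, ∑ k, J i k / 8 * ∑ a, quadCoord a (ω i) * quadCoord a (ω k))
      + ∑ i, (h * quadCoord 0 (ω i) + (s / 2 * quadCoord 2 (ω i) +
        s / 2 * quadCoord 3 (ω i)))) ∈ posCone ι quadCoord := by
    refine add_mem (sum_mem_posCone _ fun i _ => sum_mem_posCone _ fun k _ =>
      const_mul_mem_posCone (sum_mem_posCone _ fun a _ =>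
        mul_mem (coord_mem_posCone _ i a) (coord_mem_posCone _ k a)) (by have := hJ i k; positivity))
      (sum_mem_posCone _ fun i _ => add_mem ?_ (add_mem ?_ ?_)) <;>
    exact const_mul_mem_posCone (coord_mem_posCone _ i _) (by positivity)
  refine (sum_mul_exp_nonneg quadCoord_moments hF hG).trans_eq (Finset.sum_congr rfl fun ω _ => ?_)
  rw [sum_neg_hamiltonian]
  congr 1
  · simp [Fin.sum_univ_four, quadCoord, spin]
    ring
  · congr 2
    · refine Finset.sum_congr rfl fun i _ => Finset.sum_congr rfl fun k _ => ?_
      simp [Fin.sum_univ_four, quadCoord, spin]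
      ring
    · refine Finset.sum_congr rfl fun i _ => ?_
      simp [Fin.sum_univ_four, quadCoord, spin]
      ring

end Gibbs

/-- A midpoint concave function on the half-line with values in `[-1, 1]` has derivative at most
`2 / h` at `h > 0`. -/
theorem deriv_le_of_midpoint {g : ℝ → ℝ} {g' h : ℝ} (hh : 0 < h) (hb : ∀ x, |g x| ≤ 1)
    (hmid : ∀ x s, 0 ≤ x → 0 ≤ s → g (x + s) + g (x - s) ≤ 2 * g x)
    (hd : HasDerivAt (fun t => g (h + t)) g' 0) : g' ≤ 2 / h := by
  have hlim := hd.tendsto_slope_zero_right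
  simp only [zero_add, add_zero, smul_eq_mul] at hlim
  -- With step h / (n + 1), exactly n + 1 steps to the left of h reach 0. Each of them has an
  -- increment at least as large as the one to the right of h, and together they are at most 2.
  have hn : Tendsto (fun n : ℕ => h / ((n : ℝ) + 1)) atTop (𝓝[>] 0) := by
    refine tendsto_nhdsWithin_iff.2 ⟨?_, Eventually.of_forall fun n => ?_⟩
    · have := (tendsto_one_div_add_atTop_nhds_zero_nat (𝕜 := ℝ)).const_mul h
      simpa only [mul_one_div, mul_zero] using this
    · exact div_pos hh (by positivity)
  refine le_of_tendsto (hlim.comp hn) (Eventually.of_forall fun n => ?_)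
  simp only [Function.comp]
  set N : ℝ := (n : ℝ) + 1 with hN
  have hNpos : 0 < N := by positivity
  set t := h / N with ht
  have ht0 : 0 < t := by positivity
  have hNt : N * t = h := by rw [ht]; field_simp
  have step : ∀ k : ℕ, k ≤ n → g (h + t) - g h ≤ g (h - k * t) - g (h - (k + 1) * t) := by
    intro k
    induction k with
    | zero =>
      intro _
      have := hmid h t hh.le ht0.le
      simp only [Nat.cast_zero, zero_mul, sub_zero, zero_add, one_mul]
      linarith
    | succ k ih =>
      intro hk
      have h1 := ih (by omega)
      have hkN : ((k : ℝ) + 1) ≤ N := by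
        have : ((k + 1 : ℕ) : ℝ) ≤ n := by exact_mod_cast hk
        push_cast at this
        linarith
      have h2 := hmid (h - (k + 1) * t) t (by nlinarith) ht0.le
      have e1 : h - (k + 1) * t + t = h - k * t := by ring
      have e2 : h - (k + 1) * t - t = h - ((k : ℝ) + 1 + 1) * t := by ring
      rw [e1, e2] at h2
      push_cast
      linarith
  have tele : N * (g (h + t) - g h) ≤ g h - g (h - N * t) := by
    have h1 := Finset.sum_le_sum fun k (hk : k ∈ Finset.range (n + 1)) =>
      step k (by have := Finset.mem_range.1 hk; omega)
    have h2 := Finset.sum_range_sub' (fun k : ℕ => g (h - k * t)) (n + 1)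
    push_cast at h2
    rw [h2] at h1
    simpa only [Finset.sum_const, Finset.card_range, nsmul_eq_mul, Nat.cast_add, Nat.cast_one,
      zero_mul, sub_zero] using h1
  have h2 : N * (g (h + t) - g h) ≤ 2 := by
    linarith [abs_le.1 (hb h), abs_le.1 (hb (h - N * t))]
  rw [ht, inv_div, le_div_iff₀ hh]
  calc _ = N * (g (h + t) - g h) := by rw [ht]; field_simp
    _ ≤ 2 := h2

/-! ### Truncated correlations as derivatives in the field. -/

section Gibbs

variable {ι : Type*} [Fintype ι] [DecidableEq ι]

omit [Fintype ι] [DecidableEq ι] in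
theorem spin_eq_or (σ : ι → ℤˣ) (i : ι) : spin σ i = 1 ∨ spin σ i = -1 := by
  rcases Int.units_eq_one_or (σ i) with h | h <;> simp [spin, h]

omit [Fintype ι] [DecidableEq ι] in
theorem abs_spin (σ : ι → ℤˣ) (i : ι) : |spin σ i| = 1 := by
  rcases spin_eq_or σ i with h | h <;> simp [h]

theorem gibbsMean_const (J : ι → ι → ℝ) (h : ι → ℝ) (c : ℝ) : gibbsMean J h (fun _ => c) = c := by
  rw [gibbsMean, ← Finset.mul_sum]
  exact mul_div_cancel_right₀ _ (partitionFunction_pos J h).ne'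

theorem gibbsMean_mono {J : ι → ι → ℝ} {h : ι → ℝ} {F G : (ι → ℤˣ) → ℝ} (H : ∀ σ, F σ ≤ G σ) :
    gibbsMean J h F ≤ gibbsMean J h G :=
  div_le_div_of_nonneg_right (Finset.sum_le_sum fun σ _ =>
    mul_le_mul_of_nonneg_right (H σ) (Real.exp_pos _).le) (partitionFunction_pos J h).le

theorem gibbsMean_add (J : ι → ι → ℝ) (h : ι → ℝ) (F G : (ι → ℤˣ) → ℝ) :
    gibbsMean J h (fun σ => F σ + G σ) = gibbsMean J h F + gibbsMean J h G := by
  simp only [gibbsMean, add_mul, Finset.sum_add_distrib, add_div]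

theorem gibbsMean_const_mul (J : ι → ι → ℝ) (h : ι → ℝ) (c : ℝ) (F : (ι → ℤˣ) → ℝ) :
    gibbsMean J h (fun σ => c * F σ) = c * gibbsMean J h F := by
  simp only [gibbsMean, mul_assoc, ← Finset.mul_sum, mul_div_assoc]

theorem gibbsMean_sum (J : ι → ι → ℝ) (h : ι → ℝ) {κ : Type*} (s : Finset κ)
    (F : κ → (ι → ℤˣ) → ℝ) :
    gibbsMean J h (fun σ => ∑ k ∈ s, F k σ) = ∑ k ∈ s, gibbsMean J h (F k) := by
  simp only [gibbsMean, Finset.sum_mul]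
  rw [Finset.sum_comm, Finset.sum_div]

theorem abs_gibbsMean_le {J : ι → ι → ℝ} {h : ι → ℝ} {F G : (ι → ℤˣ) → ℝ}
    (H : ∀ σ, |F σ| ≤ G σ) : |gibbsMean J h F| ≤ gibbsMean J h G := by
  refine abs_le.2 ⟨?_, gibbsMean_mono fun σ => (le_abs_self _).trans (H σ)⟩
  have h1 := gibbsMean_const_mul J h (-1) G
  have h2 : gibbsMean J h (fun σ => -1 * G σ) ≤ gibbsMean J h F :=
    gibbsMean_mono fun σ => by linarith [neg_abs_le (F σ), H σ]
  linarith

theorem abs_magnetization_le (J : ι → ι → ℝ) (h : ι → ℝ) (i : ι) : |magnetization J h i| ≤ 1 := by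
  have := abs_gibbsMean_le (J := J) (h := h) fun σ => (abs_spin σ i).le
  rwa [gibbsMean_const] at this

/-- The truncated two-point function. -/
noncomputable def spinCov (J : ι → ι → ℝ) (h : ι → ℝ) (j k : ι) : ℝ :=
  gibbsMean J h (fun σ => spin σ j * spin σ k) - magnetization J h j * magnetization J h k

/-- The direction v is general to serve two purposes: a unit vector isolates one covariance, and the
constant 1 gives the susceptibility. -/
theorem hasDerivAt_magnetization (J : ι → ι → ℝ) (h v : ι → ℝ) (j : ι) :
    HasDerivAt (fun t : ℝ => magnetization J (fun i => h i + t * v i) j)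
      (∑ k, v k * spinCov J h j k) 0 := by
  have e1 : ∀ (t : ℝ) (σ : ι → ℤˣ), -hamiltonian J (fun i => h i + t * v i) σ
      = -hamiltonian J h σ + t * ∑ k, v k * spin σ k := by
    intro t σ
    simp only [hamiltonian, add_mul, Finset.sum_add_distrib, mul_assoc, ← Finset.mul_sum]
    ring
  have key : ∀ F : (ι → ℤˣ) → ℝ, HasDerivAt (fun t : ℝ => ∑ σ, F σ *
      Real.exp (-hamiltonian J (fun i => h i + t * v i) σ))
      (partitionFunction J h * ∑ k, v k * gibbsMean J h (fun σ => F σ * spin σ k)) 0 := by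
    intro F
    have h1 : HasDerivAt (fun t : ℝ => ∑ σ, F σ *
        Real.exp (-hamiltonian J h σ + t * ∑ k, v k * spin σ k))
        (∑ σ, F σ * (Real.exp (-hamiltonian J h σ + 0 * ∑ k, v k * spin σ k) *
          (1 * ∑ k, v k * spin σ k))) 0 :=
      HasDerivAt.fun_sum fun σ _ =>
        ((((hasDerivAt_id (0 : ℝ)).mul_const _).const_add _).exp).const_mul _
    simp only [e1]
    refine h1.congr_deriv ?_
    have h2 : ∑ k, v k * gibbsMean J h (fun σ => F σ * spin σ k)
        = gibbsMean J h fun σ => ∑ k, v k * (F σ * spin σ k) := by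
      simp only [gibbsMean_sum, gibbsMean_const_mul]
    rw [h2, gibbsMean, mul_div_cancel₀ _ (partitionFunction_pos J h).ne']
    refine Finset.sum_congr rfl fun σ _ => ?_
    rw [zero_mul, add_zero, one_mul, Finset.mul_sum, Finset.mul_sum, Finset.sum_mul]
    exact Finset.sum_congr rfl fun k _ => by ring
  have hZ := key fun _ => 1
  have hN := key fun σ => spin σ j
  simp only [one_mul] at hZ
  have h2 := hN.div hZ (by simpa [partitionFunction] using (partitionFunction_pos J h).ne')
  refine h2.congr_deriv ?_
  have hZ0 := (partitionFunction_pos J h).ne'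
  simp only [zero_mul, add_zero]
  have e2 : ∑ σ, spin σ j * Real.exp (-hamiltonian J h σ)
      = partitionFunction J h * magnetization J h j := by
    rw [magnetization, gibbsMean, mul_div_cancel₀ _ hZ0]
  have e3 : ∑ σ : ι → ℤˣ, Real.exp (-hamiltonian J h σ) = partitionFunction J h := rfl
  rw [e2, e3]
  simp only [spinCov, mul_sub, Finset.sum_sub_distrib]
  have e4 : ∑ k, v k * (magnetization J h j * magnetization J h k)
      = magnetization J h j * ∑ k, v k * magnetization J h k := by
    rw [Finset.mul_sum]
    exact Finset.sum_congr rfl fun k _ => by ring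
  rw [e4]
  field_simp
  rfl

theorem spinCov_nonneg {J : ι → ι → ℝ} {h : ι → ℝ} (hJ : ∀ i j, 0 ≤ J i j) (hh : ∀ i, 0 ≤ h i)
    (j k : ι) : 0 ≤ spinCov J h j k := by
  have hd := hasDerivAt_magnetization J h (Pi.single k 1) j
  simp only [Pi.single_apply, ite_mul, one_mul, zero_mul, Finset.sum_ite_eq', Finset.mem_univ,
    if_true] at hd
  have hlim := hd.tendsto_slope_zero_right
  refine ge_of_tendsto hlim (eventually_mem_nhdsWithin.mono fun t ht => ?_)
  have ht : 0 < t := ht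
  refine smul_nonneg (by positivity) (sub_nonneg.2 ?_)
  refine magnetization_mono hJ (fun _ _ => le_rfl) (fun i => ?_) (fun i => ?_) j
  · simpa using hh i
  · simp only [zero_mul, add_zero, zero_add]
    split_ifs <;> simp [ht.le]

theorem sum_spinCov_le {J : ι → ι → ℝ} {h : ℝ} (hJ : ∀ i j, 0 ≤ J i j) (hh : 0 < h) (j : ι) :
    ∑ k, spinCov J (fun _ => h) j k ≤ 2 / h := by
  have hd := hasDerivAt_magnetization J (fun _ => h) (fun _ => 1) j
  simp only [mul_one, one_mul] at hd
  exact deriv_le_of_midpoint (g := fun x => magnetization J (fun _ => x) j) hh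
    (fun x => abs_magnetization_le _ _ _)
    (fun x s hx hs => magnetization_midpoint hJ hx hs j) hd

end Gibbs

/-! ### The single-site equation and restriction to a subset of sites. -/

section Gibbs

variable {ι : Type*} [Fintype ι] [DecidableEq ι]

/-- The symmetrized couplings felt by the site `i`, without self-interaction. -/
noncomputable def siteCoupling (J : ι → ι → ℝ) (i j : ι) : ℝ :=
  if j = i then 0 else (J i j + J j i) / 2

/-- The field that the other spins exert on the site `i`. -/
noncomputable def siteField (J : ι → ι → ℝ) (i : ι) (σ : ι → ℤˣ) : ℝ :=
  ∑ j, siteCoupling J i j * spin σ j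

theorem siteField_update (J : ι → ι → ℝ) (i : ι) (σ : ι → ℤˣ) (x : ℤˣ) :
    siteField J i (Function.update σ i x) = siteField J i σ := by
  refine Finset.sum_congr rfl fun j _ => ?_
  by_cases hj : j = i
  · simp [siteCoupling, hj]
  · simp [spin, Function.update_of_ne hj]

/-- The diagonal term is invariant under the flip because σ_i² = 1, which is why `siteCoupling`
omits it. -/
theorem neg_hamiltonian_flip (J : ι → ι → ℝ) (h : ι → ℝ) (i : ι) (σ : ι → ℤˣ) :
    -hamiltonian J h (Function.update σ i (-σ i))
      = -hamiltonian J h σ - 2 * spin σ i * (h i + siteField J i σ) := by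
  have e1 : ∀ j, spin (Function.update σ i (-σ i)) j
      = spin σ j - if j = i then 2 * spin σ i else 0 := by
    intro j
    by_cases hj : j = i
    · subst hj
      simp [spin]
      ring
    · simp [spin, hj]
  have e2 : siteField J i σ = (∑ j, (J i j + J j i) / 2 * spin σ j) - J i i * spin σ i := by
    have : ∀ j, siteCoupling J i j * spin σ j = (J i j + J j i) / 2 * spin σ j
        - if j = i then (J i j + J j i) / 2 * spin σ j else 0 := by
      intro j
      by_cases hj : j = i <;> simp [siteCoupling, hj]
    simp only [siteField, this, Finset.sum_sub_distrib, Finset.sum_ite_eq', Finset.mem_univ,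
      if_true]
    ring
  have e3 : ∑ j, (J i j + J j i) / 2 * spin σ j
      = (∑ j, J i j * spin σ j) / 2 + (∑ j, J j i * spin σ j) / 2 := by
    rw [Finset.sum_div, Finset.sum_div, ← Finset.sum_add_distrib]
    exact Finset.sum_congr rfl fun j _ => by ring
  simp only [hamiltonian, e1, e2, e3, mul_sub, sub_mul, Finset.sum_sub_distrib, mul_ite, ite_mul,
    mul_zero, zero_mul, Finset.sum_ite_eq', Finset.mem_univ, if_true]
  have e4 : ∑ k, J i k * (2 * spin σ i) * spin σ k = 2 * spin σ i * ∑ j, J i j * spin σ j := by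
    rw [Finset.mul_sum]
    exact Finset.sum_congr rfl fun j _ => by ring
  have e5 : ∑ k, J k i * spin σ k * (2 * spin σ i) = 2 * spin σ i * ∑ j, J j i * spin σ j := by
    rw [Finset.mul_sum]
    exact Finset.sum_congr rfl fun j _ => by ring
  have e6 : ∀ k, (∑ x, if k = i then J k x * (2 * spin σ i) * spin σ x else 0)
      = if k = i then ∑ x, J k x * (2 * spin σ i) * spin σ x else 0 := by
    intro k
    split_ifs <;> simp
  simp only [e6, Finset.sum_ite_eq', Finset.mem_univ, if_true, e4, e5]
  ring

theorem spin_sub_tanh_mul_exp (s y : ℝ) (hs : s = 1 ∨ s = -1) :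
    s - Real.tanh y + (-s - Real.tanh y) * Real.exp (-(2 * s * y)) = 0 := by
  have h1 := Real.exp_pos y
  have h2 := Real.exp_pos (-y)
  have h3 : Real.exp (-(2 * y)) = Real.exp (-y) * Real.exp (-y) := by
    rw [← Real.exp_add]; congr 1; ring
  have h4 : Real.exp (2 * y) = Real.exp y * Real.exp y := by
    rw [← Real.exp_add]; congr 1; ring
  have h5 : Real.exp y * Real.exp (-y) = 1 := by rw [← Real.exp_add]; simp
  rw [Real.tanh_eq]
  rcases hs with rfl | rfl
  · simp only [mul_one, h3]
    field_simp
    linear_combination (-2 * Real.exp (-y)) * h5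
  · have : -(2 * (-1) * y) = 2 * y := by ring
    rw [this, h4]
    field_simp
    linear_combination (2 * Real.exp (y)) * h5

/-- The single-site Dobrushin-Lanford-Ruelle equation. -/
theorem magnetization_eq_gibbsMean_tanh (J : ι → ι → ℝ) (h : ι → ℝ) (i : ι) :
    magnetization J h i = gibbsMean J h fun σ => Real.tanh (h i + siteField J i σ) := by
  rw [magnetization, gibbsMean, gibbsMean]
  congr 1
  rw [← sub_eq_zero, ← Finset.sum_sub_distrib]
  -- Configurations are paired by the flip at i. The field at i is the same for both, and their
  -- weighted contributions cancel by `spin_sub_tanh_mul_exp`.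
  refine Finset.sum_involution (fun σ _ => Function.update σ i (-σ i)) (fun σ _ => ?_)
    (fun σ _ _ hσ => ?_) (fun _ _ => Finset.mem_univ _) (fun σ _ => by simp)
  · rw [siteField_update, neg_hamiltonian_flip, sub_eq_add_neg (-hamiltonian J h σ), Real.exp_add]
    have e1 : spin (Function.update σ i (-σ i)) i = -spin σ i := by simp [spin]
    have := spin_sub_tanh_mul_exp (spin σ i) (h i + siteField J i σ) (spin_eq_or σ i)
    rw [e1]
    linear_combination Real.exp (-hamiltonian J h σ) * this
  · have := congrFun hσ i
    simp only [Function.update_self] at this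
    exact absurd this (by rcases Int.units_eq_one_or (σ i) with h | h <;> rw [h] <;> decide)

/-- Spins outside of the image of an embedding that neither interact nor feel a field do not
influence the magnetization. -/
theorem magnetization_of_injective {κ : Type*} [Fintype κ] [DecidableEq κ] {e : κ → ι}
    (he : Function.Injective e) {J : ι → ι → ℝ} {h : ι → ℝ} {J' : κ → κ → ℝ} {h' : κ → ℝ}
    (hJ : ∀ a b, J' a b = J (e a) (e b)) (hh : ∀ a, h' a = h (e a))
    (hJ₁ : ∀ i ∉ Set.range e, ∀ j, J i j = 0) (hJ₂ : ∀ j ∉ Set.range e, ∀ i, J i j = 0)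
    (hh₀ : ∀ i ∉ Set.range e, h i = 0) (a : κ) :
    magnetization J' h' a = magnetization J h (e a) := by
  have eH : ∀ σ : ι → ℤˣ, hamiltonian J h σ = hamiltonian J' h' (σ ∘ e) := by
    intro σ
    have s1 : ∑ a, h' a * spin (σ ∘ e) a = ∑ i, h i * spin σ i :=
      Fintype.sum_of_injective e he _ _ (fun i hi => by simp [hh₀ i hi])
        fun a => by simp [hh, spin]
    have s2 : ∑ a, ∑ b, J' a b * spin (σ ∘ e) a * spin (σ ∘ e) b
        = ∑ i, ∑ j, J i j * spin σ i * spin σ j :=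
      Fintype.sum_of_injective e he _ _ (fun i hi => by simp [hJ₁ i hi]) fun a =>
        Fintype.sum_of_injective e he _ _ (fun j hj => by simp [hJ₂ j hj])
          fun b => by simp [hJ, spin]
    rw [hamiltonian, hamiltonian, s1, s2]
  -- Restriction along e pushes the uniform measure to the uniform measure: average over
  -- multiplication by ρ, extended by 1 off the image, and exchange the sums.
  have key : ∀ F : (κ → ℤˣ) → ℝ, (Fintype.card (κ → ℤˣ) : ℝ) * ∑ σ : ι → ℤˣ, F (σ ∘ e)
      = (Fintype.card (ι → ℤˣ) : ℝ) * ∑ τ, F τ := by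
    intro F
    have h1 : ∀ ρ : κ → ℤˣ, ∑ σ : ι → ℤˣ, F (σ ∘ e * ρ) = ∑ σ : ι → ℤˣ, F (σ ∘ e) := by
      intro ρ
      rw [← Equiv.sum_comp (Equiv.mulRight (Function.extend e ρ 1)) fun σ : ι → ℤˣ => F (σ ∘ e)]
      refine Finset.sum_congr rfl fun σ _ => ?_
      congr 1
      ext b
      simp [he.extend_apply]
    have h2 : ∀ σ : ι → ℤˣ, ∑ ρ : κ → ℤˣ, F (σ ∘ e * ρ) = ∑ τ, F τ := fun σ =>
      Equiv.sum_comp (Equiv.mulLeft (σ ∘ e)) F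
    calc _ = ∑ ρ : κ → ℤˣ, ∑ σ : ι → ℤˣ, F (σ ∘ e * ρ) := by
          simp only [h1, Finset.sum_const, Finset.card_univ, nsmul_eq_mul]
      _ = ∑ σ : ι → ℤˣ, ∑ ρ : κ → ℤˣ, F (σ ∘ e * ρ) := Finset.sum_comm
      _ = _ := by simp only [h2, Finset.sum_const, Finset.card_univ, nsmul_eq_mul]
  have kN := key fun τ => spin τ a * Real.exp (-hamiltonian J' h' τ)
  have kZ := key fun τ => Real.exp (-hamiltonian J' h' τ)
  simp only [← eH] at kN kZ
  have p1 : (Fintype.card (κ → ℤˣ) : ℝ) ≠ 0 := Nat.cast_ne_zero.2 Fintype.card_ne_zero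
  have p2 : (Fintype.card (ι → ℤˣ) : ℝ) ≠ 0 := Nat.cast_ne_zero.2 Fintype.card_ne_zero
  rw [magnetization, gibbsMean, magnetization, gibbsMean, ← mul_div_mul_left _ _ p2,
    ← mul_div_mul_left (∑ σ : ι → ℤˣ, _) _ p1, partitionFunction, partitionFunction, ← kN, ← kZ]
  rfl

end Gibbs

/-! ### Variance of the local field and the mean-field error. -/

section Gibbs

variable {ι : Type*} [Fintype ι] [DecidableEq ι]

/-- Comparison with J = 0, where the spins are independent. -/
theorem tanh_le_magnetization {J : ι → ι → ℝ} {h : ℝ} (hJ : ∀ i j, 0 ≤ J i j) (hh : 0 ≤ h)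
    (i : ι) : Real.tanh h ≤ magnetization J (fun _ => h) i := by
  have h1 : magnetization (fun _ _ : ι => (0 : ℝ)) (fun _ => h) i = Real.tanh h := by
    rw [magnetization_eq_gibbsMean_tanh]
    simp [siteField, siteCoupling, gibbsMean_const]
  rw [← h1]
  exact magnetization_mono (fun _ _ => le_rfl) hJ (fun _ => hh) (fun _ => le_rfl) i

theorem gibbsMean_siteField (J : ι → ι → ℝ) (h : ι → ℝ) (i : ι) :
    gibbsMean J h (siteField J i) = ∑ j, siteCoupling J i j * magnetization J h j := by
  simp only [magnetization, ← gibbsMean_const_mul, ← gibbsMean_sum]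
  rfl

theorem variance_siteField (J : ι → ι → ℝ) (h : ι → ℝ) (i : ι) :
    gibbsMean J h (fun σ => (siteField J i σ - gibbsMean J h (siteField J i)) ^ 2)
      = ∑ j, siteCoupling J i j * ∑ k, siteCoupling J i k * spinCov J h j k := by
  set μ := gibbsMean J h (siteField J i) with hμ
  have e1 : gibbsMean J h (fun σ => (siteField J i σ - μ) ^ 2)
      = gibbsMean J h (fun σ => siteField J i σ * siteField J i σ) - μ * μ := by
    have e2 : (fun σ => (siteField J i σ - μ) ^ 2) = fun σ =>
        siteField J i σ * siteField J i σ + ((-2 * μ) * siteField J i σ + μ * μ) := by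
      ext σ; ring
    rw [e2, gibbsMean_add, gibbsMean_add, gibbsMean_const_mul, gibbsMean_const, ← hμ]
    ring
  have e3 : gibbsMean J h (fun σ => siteField J i σ * siteField J i σ)
      = ∑ j, siteCoupling J i j * ∑ k, siteCoupling J i k *
        gibbsMean J h (fun σ => spin σ j * spin σ k) := by
    simp only [← gibbsMean_const_mul, ← gibbsMean_sum]
    congr 1
    ext σ
    simp only [siteField, Finset.sum_mul, Finset.mul_sum]
    exact Finset.sum_congr rfl fun j _ => Finset.sum_congr rfl fun k _ => by ring
  rw [e1, e3, hμ, gibbsMean_siteField]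
  simp only [spinCov, mul_sub, Finset.sum_sub_distrib]
  congr 1
  simp only [Finset.sum_mul, Finset.mul_sum]
  exact Finset.sum_congr rfl fun j _ => Finset.sum_congr rfl fun k _ => by ring

omit [Fintype ι] in
theorem siteCoupling_nonneg {J : ι → ι → ℝ} (hJ : ∀ i j, 0 ≤ J i j) (i j : ι) :
    0 ≤ siteCoupling J i j := by
  rw [siteCoupling]
  split_ifs
  · exact le_rfl
  · linarith [hJ i j, hJ j i]

omit [Fintype ι] in
theorem siteCoupling_le {J : ι → ι → ℝ} (hJ : ∀ i j, 0 ≤ J i j) (i j : ι) :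
    siteCoupling J i j ≤ (J i j + J j i) / 2 := by
  rw [siteCoupling]
  split_ifs
  · linarith [hJ i j, hJ j i]
  · exact le_rfl

/-- One coupling is replaced by A, which leaves the susceptibility bound 2 / h; the other is summed
to B. Non-negative covariances make the first replacement legitimate. -/
theorem variance_siteField_le {J : ι → ι → ℝ} {h A B : ℝ} {i : ι} (hJ : ∀ i j, 0 ≤ J i j)
    (hA : ∀ i j, J i j ≤ A) (hB : ∑ j, (J i j + J j i) / 2 ≤ B) (hh : 0 < h) :
    gibbsMean J (fun _ => h)
        (fun σ => (siteField J i σ - gibbsMean J (fun _ => h) (siteField J i)) ^ 2)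
      ≤ B * (A * (2 / h)) := by
  have hA0 : 0 ≤ A := (hJ i i).trans (hA i i)
  have h1 : ∀ j, ∑ k, siteCoupling J i k * spinCov J (fun _ => h) j k ≤ A * (2 / h) := by
    intro j
    calc _ ≤ ∑ k, A * spinCov J (fun _ => h) j k := by
          refine Finset.sum_le_sum fun k _ => mul_le_mul_of_nonneg_right ?_
            (spinCov_nonneg hJ (fun _ => hh.le) j k)
          linarith [siteCoupling_le hJ i k, hA i k, hA k i]
      _ ≤ _ := by
          rw [← Finset.mul_sum]
          exact mul_le_mul_of_nonneg_left (sum_spinCov_le hJ hh j) hA0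
  rw [variance_siteField]
  calc _ ≤ ∑ j, (J i j + J j i) / 2 * (A * (2 / h)) := by
        refine Finset.sum_le_sum fun j _ => ?_
        exact (mul_le_mul_of_nonneg_left (h1 j) (siteCoupling_nonneg hJ i j)).trans
          (mul_le_mul_of_nonneg_right (siteCoupling_le hJ i j) (by positivity))
    _ ≤ _ := by
        rw [← Finset.sum_mul]
        exact mul_le_mul_of_nonneg_right hB (by positivity)

omit [DecidableEq ι] in
theorem abs_sum_coupling_le {a b x : ι → ℝ} {B : ℝ} (ha : ∀ j, 0 ≤ a j) (hab : ∀ j, a j ≤ b j)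
    (hB : ∑ j, b j ≤ B) (hx : ∀ j, |x j| ≤ 1) : |∑ j, a j * x j| ≤ B := by
  refine (Finset.abs_sum_le_sum_abs _ _).trans ((Finset.sum_le_sum fun j _ => ?_).trans hB)
  rw [abs_mul, abs_of_nonneg (ha j)]
  exact (mul_le_of_le_one_right (ha j) (hx j)).trans (hab j)

/-- The mean-field equation with an error governed by the size `A` of the couplings. -/
theorem abs_magnetization_sub_tanh_le {J : ι → ι → ℝ} {h A B : ℝ} {i : ι}
    (hJ : ∀ i j, 0 ≤ J i j) (hA : ∀ i j, J i j ≤ A) (hB : ∑ j, (J i j + J j i) / 2 ≤ B)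
    (hh : 0 < h) :
    |magnetization J (fun _ => h) i
        - Real.tanh (h + ∑ j, (J i j + J j i) / 2 * magnetization J (fun _ => h) j)|
      ≤ 4 * Real.exp (-(2 * (h - B))) * A * (1 + 4 * B / h) := by
  set m := magnetization J fun _ => h with hm
  set μ := gibbsMean J (fun _ => h) (siteField J i) with hμ
  set c := h - B with hc
  have hA0 : 0 ≤ A := (hJ i i).trans (hA i i)
  have hs0 : ∀ j, 0 ≤ (J i j + J j i) / 2 := fun j => by linarith [hJ i j, hJ j i]
  have b1 : ∀ σ, c ≤ h + siteField J i σ := fun σ => by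
    have := abs_sum_coupling_le (siteCoupling_nonneg hJ i) (siteCoupling_le hJ i) hB
      fun j => (abs_spin σ j).le
    have h2 := (abs_le.1 this).1
    rw [hc, siteField]
    linarith
  have b2 : c ≤ h + μ := by
    have := abs_sum_coupling_le (siteCoupling_nonneg hJ i) (siteCoupling_le hJ i) hB
      (abs_magnetization_le J fun _ => h)
    have h2 := (abs_le.1 this).1
    rw [hμ, gibbsMean_siteField]
    linarith
  have b3 : c ≤ h + ∑ j, (J i j + J j i) / 2 * m j := by
    have := abs_sum_coupling_le hs0 (fun _ => le_rfl) hB (abs_magnetization_le J fun _ => h)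
    have h2 := (abs_le.1 this).1
    linarith
  have s1 : |m i - Real.tanh (h + μ)| ≤ 8 * Real.exp (-(2 * c)) * (B * (A * (2 / h))) := by
    -- The linear term can be inserted for free, since μ is the mean of the field.
    have e1 : m i - Real.tanh (h + μ) = gibbsMean J (fun _ => h) fun σ =>
        Real.tanh (h + siteField J i σ) - Real.tanh (h + μ)
          - (1 - Real.tanh (h + μ) ^ 2) * (h + siteField J i σ - (h + μ)) := by
      set t := Real.tanh (h + μ)
      have e2 : (fun σ => Real.tanh (h + siteField J i σ) - t
          - (1 - t ^ 2) * (h + siteField J i σ - (h + μ))) = fun σ =>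
          Real.tanh (h + siteField J i σ)
            + ((-(1 - t ^ 2)) * siteField J i σ + ((1 - t ^ 2) * μ - t)) := by
        ext σ; ring
      rw [e2, gibbsMean_add, gibbsMean_add, gibbsMean_const_mul, gibbsMean_const, ← hμ, hm,
        magnetization_eq_gibbsMean_tanh]
      ring
    rw [e1]
    refine (abs_gibbsMean_le fun σ => abs_tanh_taylor_le b2 (b1 σ)).trans ?_
    rw [gibbsMean_const_mul]
    refine mul_le_mul_of_nonneg_left ?_ (by positivity)
    simpa only [add_sub_add_left_eq_sub] using variance_siteField_le hJ hA hB hh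
  -- The two arguments differ by the self-coupling J i i * m i, of size at most A.
  have s2 : |Real.tanh (h + μ) - Real.tanh (h + ∑ j, (J i j + J j i) / 2 * m j)|
      ≤ 4 * Real.exp (-(2 * c)) * A := by
    refine (abs_tanh_sub_tanh_le b3 b2).trans (mul_le_mul_of_nonneg_left ?_ (by positivity))
    have e1 : h + μ - (h + ∑ j, (J i j + J j i) / 2 * m j) = -(J i i * m i) := by
      rw [hμ, gibbsMean_siteField, add_sub_add_left_eq_sub, ← Finset.sum_sub_distrib,
        Finset.sum_eq_single i]
      · simp [siteCoupling]
      · intro j _ hj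
        simp [siteCoupling, hj, hm]
      · simp
    rw [e1, abs_neg, abs_mul, abs_of_nonneg (hJ i i)]
    exact (mul_le_of_le_one_right (hJ i i) (abs_magnetization_le _ _ _)).trans (hA i i)
  calc _ ≤ 8 * Real.exp (-(2 * c)) * (B * (A * (2 / h))) + 4 * Real.exp (-(2 * c)) * A :=
        (abs_sub_le _ _ _).trans (add_le_add s1 s2)
    _ = _ := by ring

/-- Both quantities lie in [tanh h, 1]. No bound on the couplings enters, so this covers large λ. -/
theorem abs_magnetization_sub_tanh_le_exp {J : ι → ι → ℝ} {h : ℝ} (hJ : ∀ i j, 0 ≤ J i j)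
    (hh : 0 < h) (i : ι) :
    |magnetization J (fun _ => h) i
        - Real.tanh (h + ∑ j, (J i j + J j i) / 2 * magnetization J (fun _ => h) j)|
      ≤ 2 * Real.exp (-(2 * h)) := by
  have h1 := one_sub_tanh_le h
  have h2 := tanh_le_magnetization hJ hh.le i
  have h3 := (abs_le.1 (abs_magnetization_le J (fun _ => h) i)).2
  have h4 : 0 ≤ ∑ j, (J i j + J j i) / 2 * magnetization J (fun _ => h) j :=
    Finset.sum_nonneg fun j _ => mul_nonneg (by linarith [hJ i j, hJ j i])
      ((tanh_nonneg hh.le).trans (tanh_le_magnetization hJ hh.le j))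
  have h5 := monotone_tanh (le_add_of_nonneg_right (a := h) h4)
  have h6 := Real.tanh_lt_one
    (h + ∑ j, (J i j + J j i) / 2 * magnetization J (fun _ => h) j)
  rw [abs_le]
  constructor <;> linarith

end Gibbs

/-! ### Riemann sums of f over the scaled lattice. -/

section RiemannSums

variable {d : ℕ}

theorem scaledPoint_mem_cell {lam : ℝ} (hlam : 0 < lam) (i : Fin d → ℤ) :
    scaledPoint lam i ∈ cell lam i :=
  fun _ => ⟨le_rfl, mul_lt_mul_of_pos_left (lt_add_one _) hlam⟩

theorem cell_eq_pi (δ : ℝ) (k : Fin d → ℤ) :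
    cell δ k = Set.univ.pi fun l => Set.Ico (δ * (k l : ℝ)) (δ * ((k l : ℝ) + 1)) := by
  ext x
  simp [cell]

theorem measurableSet_cell (δ : ℝ) (k : Fin d → ℤ) : MeasurableSet (cell δ k) := by
  rw [cell_eq_pi]
  exact MeasurableSet.univ_pi fun _ => measurableSet_Ico

theorem volume_cell {δ : ℝ} (hδ : 0 < δ) (k : Fin d → ℤ) :
    volume (cell δ k) = ENNReal.ofReal (δ ^ d) := by
  rw [cell_eq_pi, Real.volume_pi_Ico]
  have : ∀ l, δ * ((k l : ℝ) + 1) - δ * (k l : ℝ) = δ := fun l => by ring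
  simp [this, ENNReal.ofReal_pow hδ.le]

theorem mem_cell_iff {δ : ℝ} (hδ : 0 < δ) (k : Fin d → ℤ) (x : Fin d → ℝ) :
    x ∈ cell δ k ↔ (fun l => ⌊x l / δ⌋) = k := by
  rw [funext_iff]
  refine forall_congr' fun l => ?_
  rw [Int.floor_eq_iff, le_div_iff₀ hδ, div_lt_iff₀ hδ, mul_comm δ, mul_comm δ]

theorem lintegral_eq_tsum_cell {δ : ℝ} (hδ : 0 < δ) (g : (Fin d → ℝ) → ℝ≥0∞) :
    ∫⁻ x, g x = ∑' k : Fin d → ℤ, ∫⁻ x in cell δ k, g x := by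
  rw [← lintegral_iUnion (measurableSet_cell δ), Set.iUnion_eq_univ_iff.2, setLIntegral_univ]
  · exact fun x => ⟨_, (mem_cell_iff hδ _ x).2 rfl⟩
  · intro k k' hkk'
    refine Set.disjoint_left.2 fun x hx hx' => hkk' ?_
    rw [← (mem_cell_iff hδ k x).1 hx, ← (mem_cell_iff hδ k' x).1 hx']

theorem lowerSum_le_lintegral {δ : ℝ} (hδ : 0 < δ) (f : (Fin d → ℝ) → ℝ) :
    lowerSum f δ ≤ ∫⁻ x, ENNReal.ofReal (f x) := by
  rw [lintegral_eq_tsum_cell hδ]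
  refine ENNReal.tsum_le_tsum fun k => ?_
  rw [← volume_cell hδ k, mul_comm, ← setLIntegral_const]
  exact setLIntegral_mono' (measurableSet_cell δ k) fun x hx => iInf₂_le x hx

theorem lintegral_le_upperSum {δ : ℝ} (hδ : 0 < δ) (f : (Fin d → ℝ) → ℝ) :
    ∫⁻ x, ENNReal.ofReal (f x) ≤ upperSum f δ := by
  rw [lintegral_eq_tsum_cell hδ]
  refine ENNReal.tsum_le_tsum fun k => ?_
  rw [← volume_cell hδ k, mul_comm, ← setLIntegral_const]
  exact setLIntegral_mono' (measurableSet_cell δ k) fun x hx =>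
    le_iSup₂ (f := fun x (_ : x ∈ cell δ k) => ENNReal.ofReal (f x)) x hx

variable {f : (Fin d → ℝ) → ℝ}

theorem lowerSum_le_tsum {lam : ℝ} (hlam : 0 < lam) :
    lowerSum f lam ≤ ∑' i : Fin d → ℤ, ENNReal.ofReal (lam ^ d * f (scaledPoint lam i)) := by
  refine ENNReal.tsum_le_tsum fun i => ?_
  rw [ENNReal.ofReal_mul (by positivity)]
  gcongr
  exact iInf₂_le _ (scaledPoint_mem_cell hlam i)

theorem tsum_le_upperSum {lam : ℝ} (hlam : 0 < lam) :
    ∑' i : Fin d → ℤ, ENNReal.ofReal (lam ^ d * f (scaledPoint lam i)) ≤ upperSum f lam := by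
  refine ENNReal.tsum_le_tsum fun i => ?_
  rw [ENNReal.ofReal_mul (by positivity)]
  gcongr
  exact le_iSup₂ (f := fun x (_ : x ∈ cell lam i) => ENNReal.ofReal (f x)) _
    (scaledPoint_mem_cell hlam i)

theorem summable_scaledPoint (hf : ∀ x, 0 ≤ f x) (hR : RiemannIntegrable f) {lam : ℝ}
    (hlam : 0 < lam) : Summable fun i : Fin d → ℤ => lam ^ d * f (scaledPoint lam i) := by
  have h := ENNReal.summable_toReal (ne_top_of_le_ne_top (hR.1 lam hlam) (tsum_le_upperSum hlam))
  refine h.congr fun i => ENNReal.toReal_ofReal ?_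
  exact mul_nonneg (by positivity) (hf _)

/-- The lattice sum and the integral both lie between the lower and the upper sum. -/
theorem abs_tsum_scaledPoint_sub_one_le (hf : ∀ x, 0 ≤ f x) (hR : RiemannIntegrable f)
    (hprob : ∫ x, f x = 1) {lam : ℝ} (hlam : 0 < lam) :
    |(∑' i : Fin d → ℤ, lam ^ d * f (scaledPoint lam i)) - 1|
      ≤ (upperSum f lam - lowerSum f lam).toReal := by
  have hU := hR.1 lam hlam
  -- A non-integrable function has Bochner integral 0, so integral 1 forces integrability.
  have hint : Integrable f := by
    by_contra hne
    rw [integral_undef hne] at hprob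
    exact zero_ne_one hprob
  have h1 : ∫⁻ x, ENNReal.ofReal (f x) = 1 := by
    rw [← ofReal_integral_eq_lintegral_ofReal hint (Eventually.of_forall hf), hprob,
      ENNReal.ofReal_one]
  have a1 := h1 ▸ lowerSum_le_lintegral hlam f
  have a2 := h1 ▸ lintegral_le_upperSum hlam f
  have a3 := lowerSum_le_tsum (f := f) hlam
  have a4 := tsum_le_upperSum (f := f) hlam
  have hL := ne_top_of_le_ne_top hU (a1.trans a2)
  have e1 : (∑' i : Fin d → ℤ, lam ^ d * f (scaledPoint lam i))
      = (∑' i : Fin d → ℤ, ENNReal.ofReal (lam ^ d * f (scaledPoint lam i))).toReal := by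
    rw [← ENNReal.ofReal_tsum_of_nonneg (fun i => mul_nonneg (by positivity) (hf _))
      (summable_scaledPoint hf hR hlam), ENNReal.toReal_ofReal]
    exact tsum_nonneg fun i => mul_nonneg (by positivity) (hf _)
  rw [e1, ENNReal.toReal_sub_of_le (a1.trans a2) hU, abs_le]
  have b1 := ENNReal.toReal_mono ENNReal.one_ne_top a1
  have b2 := ENNReal.toReal_mono hU a2
  have b3 := ENNReal.toReal_mono (ne_top_of_le_ne_top hU a4) a3
  have b4 := ENNReal.toReal_mono hU a4
  rw [ENNReal.toReal_one] at b1 b2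
  constructor <;> linarith

theorem tendsto_tsum_scaledPoint (hf : ∀ x, 0 ≤ f x) (hR : RiemannIntegrable f)
    (hprob : ∫ x, f x = 1) :
    Tendsto (fun lam : ℝ => ∑' i : Fin d → ℤ, lam ^ d * f (scaledPoint lam i)) (𝓝[>] 0)
      (𝓝 1) := by
  have h1 := (ENNReal.tendsto_toReal ENNReal.zero_ne_top).comp hR.2
  rw [ENNReal.toReal_zero] at h1
  rw [tendsto_iff_norm_sub_tendsto_zero]
  refine squeeze_zero' (Eventually.of_forall fun _ => norm_nonneg _)
    (eventually_mem_nhdsWithin.mono fun lam hlam => ?_) h1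
  exact abs_tsum_scaledPoint_sub_one_le hf hR hprob hlam

end RiemannSums

/-! ### The Kac model: infinite volume and uniform error bounds. -/

section Kac

variable {d : ℕ} {f : (Fin d → ℝ) → ℝ} {β lam h : ℝ}

theorem kacCoupling_nonneg (hf : ∀ x, 0 ≤ f x) (hβ : 0 < β) (hlam : 0 < lam)
    (i j : Fin d → ℤ) : 0 ≤ kacCoupling f β lam i j :=
  mul_nonneg (by positivity) (hf _)

theorem kacMagnetization_of_mem {Λ : Finset (Fin d → ℤ)} {i : Fin d → ℤ} (hi : i ∈ Λ) :
    kacMagnetization f β lam h Λ i =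
      magnetization (ι := Λ) (fun j k => kacCoupling f β lam j.1 k.1) (fun _ => h) ⟨i, hi⟩ :=
  dif_pos hi

theorem kacMagnetization_of_notMem {Λ : Finset (Fin d → ℤ)} {i : Fin d → ℤ} (hi : i ∉ Λ) :
    kacMagnetization f β lam h Λ i = 0 :=
  dif_neg hi

theorem abs_kacMagnetization_le (Λ : Finset (Fin d → ℤ)) (i : Fin d → ℤ) :
    |kacMagnetization f β lam h Λ i| ≤ 1 := by
  by_cases hi : i ∈ Λ
  · rw [kacMagnetization_of_mem hi]
    exact abs_magnetization_le _ _ _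
  · simp [kacMagnetization_of_notMem hi]

theorem kacMagnetization_nonneg (hf : ∀ x, 0 ≤ f x) (hβ : 0 < β) (hlam : 0 < lam) (hh : 0 < h)
    (Λ : Finset (Fin d → ℤ)) (i : Fin d → ℤ) : 0 ≤ kacMagnetization f β lam h Λ i := by
  by_cases hi : i ∈ Λ
  · rw [kacMagnetization_of_mem hi]
    exact (tanh_nonneg hh.le).trans
      (tanh_le_magnetization (J := fun j k : Λ => kacCoupling f β lam j.1 k.1)
        (fun j k => kacCoupling_nonneg hf hβ hlam j.1 k.1) hh.le _)
  · rw [kacMagnetization_of_notMem hi]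

/-- The smaller volume is the larger one with couplings and fields switched off outside, so
Griffiths' monotonicity applies. For i outside Λ the value 0 is a lower bound by positivity. -/
theorem kacMagnetization_mono (hf : ∀ x, 0 ≤ f x) (hβ : 0 < β) (hlam : 0 < lam) (hh : 0 < h)
    (i : Fin d → ℤ) : Monotone fun Λ => kacMagnetization f β lam h Λ i := by
  intro Λ Λ' hΛ
  by_cases hi : i ∈ Λ
  · simp only [kacMagnetization_of_mem hi, kacMagnetization_of_mem (hΛ hi)]
    have hr : ∀ j : Λ', j ∉ Set.range (fun x : Λ => (⟨x.1, hΛ x.2⟩ : Λ')) → j.1 ∉ Λ :=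
      fun j hj hjΛ => hj ⟨⟨j.1, hjΛ⟩, rfl⟩
    have e1 := magnetization_of_injective (e := fun x : Λ => (⟨x.1, hΛ x.2⟩ : Λ'))
      (fun x y hxy => Subtype.ext (congrArg (fun z : Λ' => z.1) hxy))
      (J := fun j k => if j.1 ∈ Λ ∧ k.1 ∈ Λ then kacCoupling f β lam j.1 k.1 else 0)
      (h := fun j => if j.1 ∈ Λ then h else 0)
      (J' := fun j k => kacCoupling f β lam j.1 k.1) (h' := fun _ => h)
      (fun a b => by simp) (fun a => by simp) (fun j hj k => by simp [hr j hj])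
      (fun j hj k => by simp [hr j hj]) (fun j hj => by simp [hr j hj]) ⟨i, hi⟩
    rw [e1]
    refine magnetization_mono (fun j k => ?_) (fun j k => ?_) (fun j => ?_) (fun j => ?_) _
    · split_ifs
      exacts [kacCoupling_nonneg hf hβ hlam _ _, le_rfl]
    · split_ifs
      exacts [le_rfl, kacCoupling_nonneg hf hβ hlam _ _]
    · split_ifs
      exacts [hh.le, le_rfl]
    · split_ifs
      exacts [le_rfl, hh.le]
  · simp only [kacMagnetization_of_notMem hi]
    exact kacMagnetization_nonneg hf hβ hlam hh _ _

theorem kacMagnetization_translate (Λ : Finset (Fin d → ℤ)) (i k : Fin d → ℤ) :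
    kacMagnetization f β lam h (Λ.map (addRightEmbedding k)) (i + k)
      = kacMagnetization f β lam h Λ i := by
  by_cases hi : i ∈ Λ
  · have hi' : i + k ∈ Λ.map (addRightEmbedding k) := Finset.mem_map.2 ⟨i, hi, rfl⟩
    rw [kacMagnetization_of_mem hi, kacMagnetization_of_mem hi']
    have hr : ∀ j : (Λ.map (addRightEmbedding k) : Finset (Fin d → ℤ)), j ∈ Set.range
        (fun x : Λ => (⟨x.1 + k, Finset.mem_map.2 ⟨x.1, x.2, rfl⟩⟩ :
          (Λ.map (addRightEmbedding k) : Finset (Fin d → ℤ)))) := by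
      rintro ⟨j, hj⟩
      obtain ⟨x, hx, rfl⟩ := Finset.mem_map.1 hj
      exact ⟨⟨x, hx⟩, rfl⟩
    refine (magnetization_of_injective (e := fun x : Λ => (⟨x.1 + k, Finset.mem_map.2
        ⟨x.1, x.2, rfl⟩⟩ : (Λ.map (addRightEmbedding k) : Finset (Fin d → ℤ))))
      (fun x y hxy => Subtype.ext (add_right_cancel (congrArg Subtype.val hxy))) ?_
      (fun _ => rfl) (fun j hj => (hj (hr j)).elim) (fun j hj => (hj (hr j)).elim)
      (fun j hj => (hj (hr j)).elim) ⟨i, hi⟩).symm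
    intro a b
    simp [kacCoupling]
  · have hi' : i + k ∉ Λ.map (addRightEmbedding k) := by
      intro hc
      obtain ⟨x, hx, hxi⟩ := Finset.mem_map.1 hc
      exact hi (add_right_cancel hxi ▸ hx)
    rw [kacMagnetization_of_notMem hi, kacMagnetization_of_notMem hi']

/-- The infinite-volume magnetization. -/
noncomputable def kacLimit (f : (Fin d → ℝ) → ℝ) (β lam h : ℝ) : ℝ :=
  ⨆ Λ : Finset (Fin d → ℤ), kacMagnetization f β lam h Λ 0

theorem iSup_kacMagnetization (i : Fin d → ℤ) :
    ⨆ Λ : Finset (Fin d → ℤ), kacMagnetization f β lam h Λ i = kacLimit f β lam h := by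
  symm
  refine Function.Surjective.iSup_congr (fun Λ => Λ.map (addRightEmbedding i)) (fun Λ => ?_)
    fun Λ => ?_
  · refine ⟨Λ.map (addRightEmbedding (-i)), ?_⟩
    ext x
    simp
  · have := kacMagnetization_translate (f := f) (β := β) (lam := lam) (h := h) Λ 0 i
    rwa [zero_add] at this

theorem tendsto_kacMagnetization (hf : ∀ x, 0 ≤ f x) (hβ : 0 < β) (hlam : 0 < lam) (hh : 0 < h)
    (i : Fin d → ℤ) :
    Tendsto (fun Λ => kacMagnetization f β lam h Λ i) atTop (𝓝 (kacLimit f β lam h)) := by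
  rw [← iSup_kacMagnetization i]
  refine tendsto_atTop_ciSup (kacMagnetization_mono hf hβ hlam hh i) ⟨1, ?_⟩
  rintro _ ⟨Λ, rfl⟩
  exact (abs_le.1 (abs_kacMagnetization_le Λ i)).2

theorem kacLimit_mem_Icc (hf : ∀ x, 0 ≤ f x) (hβ : 0 < β) (hlam : 0 < lam) (hh : 0 < h) :
    kacLimit f β lam h ∈ Set.Icc (0 : ℝ) 1 :=
  isClosed_Icc.mem_of_tendsto (tendsto_kacMagnetization hf hβ hlam hh 0)
    (Eventually.of_forall fun Λ => ⟨kacMagnetization_nonneg hf hβ hlam hh Λ 0,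
      (abs_le.1 (abs_kacMagnetization_le Λ 0)).2⟩)

/-- Translation and reflection of the lattice give J_ij and J_ji the same total over j, so the
symmetrization disappears in infinite volume even if f is not even. -/
theorem hasSum_kacCoupling
    (hs : Summable fun i : Fin d → ℤ => lam ^ d * f (scaledPoint lam i)) (i : Fin d → ℤ) :
    HasSum (fun j => (kacCoupling f β lam i j + kacCoupling f β lam j i) / 2)
      (β * ∑' i : Fin d → ℤ, lam ^ d * f (scaledPoint lam i)) := by
  have h0 := hs.hasSum
  have h1 := (Equiv.subLeft i).hasSum_iff.2 h0
  have h2 := (Equiv.subRight i).hasSum_iff.2 h0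
  have h3 := ((h1.mul_left β).add (h2.mul_left β)).div_const 2
  have e1 : (fun j => (kacCoupling f β lam i j + kacCoupling f β lam j i) / 2) = fun j =>
      (β * ((fun i : Fin d → ℤ => lam ^ d * f (scaledPoint lam i)) ∘ Equiv.subLeft i) j
        + β * ((fun i : Fin d → ℤ => lam ^ d * f (scaledPoint lam i)) ∘ Equiv.subRight i) j) / 2 := by
    ext j
    simp [kacCoupling, mul_assoc]
  rw [add_self_div_two] at h3
  rwa [e1]

theorem sum_kacCoupling_subtype (Λ : Finset (Fin d → ℤ)) (i : Fin d → ℤ) :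
    ∑ j ∈ Λ, (kacCoupling f β lam i j + kacCoupling f β lam j i) / 2
        * kacMagnetization f β lam h Λ j
      = ∑ j : Λ, (kacCoupling f β lam i j + kacCoupling f β lam j i) / 2
        * magnetization (ι := Λ) (fun j k => kacCoupling f β lam j.1 k.1) (fun _ => h) j := by
  rw [← Finset.sum_coe_sort]
  exact Finset.sum_congr rfl fun j _ => by rw [kacMagnetization_of_mem j.2]

/-- Since the magnetization is 0 outside Λ, the finite sum is a full series, dominated by the
summable couplings. -/
theorem tendsto_sum_kacCoupling (hf : ∀ x, 0 ≤ f x) (hβ : 0 < β) (hlam : 0 < lam) (hh : 0 < h)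
    (hs : Summable fun i : Fin d → ℤ => lam ^ d * f (scaledPoint lam i)) (i : Fin d → ℤ) :
    Tendsto (fun Λ => ∑ j ∈ Λ, (kacCoupling f β lam i j + kacCoupling f β lam j i) / 2
        * kacMagnetization f β lam h Λ j) atTop
      (𝓝 (β * kacLimit f β lam h * ∑' i : Fin d → ℤ, lam ^ d * f (scaledPoint lam i))) := by
  have hJ := hasSum_kacCoupling (β := β) hs i
  have e1 : ∀ Λ : Finset (Fin d → ℤ),
      ∑' j, (kacCoupling f β lam i j + kacCoupling f β lam j i) / 2
        * kacMagnetization f β lam h Λ j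
      = ∑ j ∈ Λ, (kacCoupling f β lam i j + kacCoupling f β lam j i) / 2
        * kacMagnetization f β lam h Λ j := fun Λ =>
    tsum_eq_sum fun j hj => by rw [kacMagnetization_of_notMem hj, mul_zero]
  have e2 := (hJ.mul_right (kacLimit f β lam h)).tsum_eq
  have e3 : β * kacLimit f β lam h * ∑' i : Fin d → ℤ, lam ^ d * f (scaledPoint lam i)
      = ∑' j, (kacCoupling f β lam i j + kacCoupling f β lam j i) / 2
        * kacLimit f β lam h := by
    rw [e2]; ring
  rw [e3]
  simp only [← e1]
  refine tendsto_tsum_of_dominated_convergence hJ.summable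
    (fun j => (tendsto_kacMagnetization hf hβ hlam hh j).const_mul _)
    (Eventually.of_forall fun Λ j => ?_)
  have h0 : 0 ≤ (kacCoupling f β lam i j + kacCoupling f β lam j i) / 2 := by
    linarith [kacCoupling_nonneg hf hβ hlam i j, kacCoupling_nonneg hf hβ hlam j i]
  rw [norm_mul, Real.norm_of_nonneg h0]
  exact mul_le_of_le_one_right h0 (abs_kacMagnetization_le Λ j)

/-- The mean-field equation in finite volume, with an error uniform in the volume. -/
theorem exists_meanField_bound (hf : ∀ x, 0 ≤ f x) (hb : ∃ M : ℝ, ∀ x, f x ≤ M)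
    (hR : RiemannIntegrable f) (hprob : ∫ x, f x = 1) (hβ : 0 < β) :
    ∃ C : ℝ, 0 ≤ C ∧ ∀ lam h : ℝ, 0 < lam → 0 < h → ∀ (Λ : Finset (Fin d → ℤ)), ∀ i ∈ Λ,
      |kacMagnetization f β lam h Λ i - Real.tanh (h + ∑ j ∈ Λ,
          (kacCoupling f β lam i j + kacCoupling f β lam j i) / 2
            * kacMagnetization f β lam h Λ j)|
        ≤ C * (lam ^ d * (Real.exp (-(2 * h)) * (1 + 1 / h))) := by
  obtain ⟨M, hM⟩ := hb
  have hM0 : 0 ≤ M := (hf 0).trans (hM 0)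
  have hev := (tendsto_tsum_scaledPoint hf hR hprob).eventually_le_const one_lt_two
  -- Below l₀ the Riemann sum is at most 2, so row sums are at most 2β; from l₀ on, the factor lam ^
  -- d / l₀ ^ d ≥ 1 absorbs the trivial bound.
  obtain ⟨l₀, hl₀, hS⟩ := mem_nhdsGT_iff_exists_Ioo_subset.1 hev
  have hl₀ : 0 < l₀ := hl₀
  refine ⟨4 * Real.exp (4 * β) * (β * M) * (1 + 8 * β) + 2 / l₀ ^ d, by positivity, ?_⟩
  intro lam h hlam hh Λ i hi
  have hJ : ∀ j k : Λ, 0 ≤ kacCoupling f β lam j.1 k.1 :=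
    fun j k => kacCoupling_nonneg hf hβ hlam _ _
  rw [sum_kacCoupling_subtype, kacMagnetization_of_mem hi]
  have hX : 0 ≤ lam ^ d * (Real.exp (-(2 * h)) * (1 + 1 / h)) := by positivity
  rw [add_mul]
  rcases lt_or_ge lam l₀ with hlt | hge
  · have hS2 : ∑' i : Fin d → ℤ, lam ^ d * f (scaledPoint lam i) ≤ 2 := hS ⟨hlam, hlt⟩
    have hB : ∑ j : Λ, (kacCoupling f β lam i j + kacCoupling f β lam j i) / 2 ≤ 2 * β := by
      rw [Finset.sum_coe_sort Λ
        fun j => (kacCoupling f β lam i j + kacCoupling f β lam j i) / 2]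
      refine (sum_le_hasSum _ (fun j _ => ?_)
        (hasSum_kacCoupling (summable_scaledPoint hf hR hlam) i)).trans ?_
      · linarith [kacCoupling_nonneg hf hβ hlam i j, kacCoupling_nonneg hf hβ hlam j i]
      · nlinarith
    have hA : ∀ j k : Λ, kacCoupling f β lam j.1 k.1 ≤ β * lam ^ d * M := fun j k =>
      mul_le_mul_of_nonneg_left (hM _) (by positivity)
    refine (abs_magnetization_sub_tanh_le (J := fun j k : Λ => kacCoupling f β lam j.1 k.1)
      (i := ⟨i, hi⟩) hJ hA hB hh).trans
      (le_add_of_le_of_nonneg ?_ (by positivity))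
    have e1 : Real.exp (-(2 * (h - 2 * β))) = Real.exp (4 * β) * Real.exp (-(2 * h)) := by
      rw [← Real.exp_add]; congr 1; ring
    have e2 : 1 + 4 * (2 * β) / h ≤ (1 + 8 * β) * (1 + 1 / h) := by
      have : (1 + 8 * β) * (1 + 1 / h) = 1 + 4 * (2 * β) / h + (8 * β + 1 / h) := by ring
      rw [this]
      exact le_add_of_nonneg_right (by positivity)
    calc _ ≤ 4 * Real.exp (-(2 * (h - 2 * β))) * (β * lam ^ d * M)
          * ((1 + 8 * β) * (1 + 1 / h)) := by gcongr
      _ = _ := by rw [e1]; ring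
  · refine (abs_magnetization_sub_tanh_le_exp
      (J := fun j k : Λ => kacCoupling f β lam j.1 k.1) hJ hh ⟨i, hi⟩).trans
      (le_add_of_nonneg_of_le (by positivity) ?_)
    have e1 : 1 ≤ lam ^ d / l₀ ^ d := by
      rw [one_le_div (by positivity)]
      exact pow_le_pow_left₀ hl₀.le hge d
    have e2 : 1 ≤ 1 + 1 / h := le_add_of_nonneg_right (by positivity)
    calc _ = 1 * (2 * Real.exp (-(2 * h))) * 1 := by ring
      _ ≤ lam ^ d / l₀ ^ d * (2 * Real.exp (-(2 * h))) * (1 + 1 / h) := by gcongr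
      _ = _ := by ring

/-- Already 1 / h is an upper bound, by h + 1 ≤ e^h; the logarithm is slack. -/
theorem exp_mul_le_log_div (hh : 0 < h) :
    Real.exp (-(2 * h)) * (1 + 1 / h) ≤ (1 + |Real.log h|) / h := by
  have h1 : Real.exp (-(2 * h)) * Real.exp h ≤ 1 := by
    rw [← Real.exp_add, Real.exp_le_one_iff]; linarith
  have h2 := Real.add_one_le_exp h
  have e1 : Real.exp (-(2 * h)) * (1 + 1 / h) = Real.exp (-(2 * h)) * (h + 1) / h := by
    field_simp
  rw [e1]
  gcongr
  have h3 := mul_le_mul_of_nonneg_left h2 (Real.exp_pos (-(2 * h))).le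
  linarith [abs_nonneg (Real.log h)]

theorem exp_mul_le_one_div (hh : 1 < h) :
    Real.exp (-(2 * h)) * (1 + 1 / h) ≤ 1 / (h * Real.log h) := by
  have hh0 : 0 < h := by linarith
  have hl := Real.log_pos hh
  rw [le_div_iff₀ (by positivity)]
  have h1 : Real.exp (-(2 * h)) * (Real.exp h * Real.exp h) = 1 := by
    rw [← Real.exp_add, ← Real.exp_add, Real.exp_eq_one_iff]; ring
  have h2 := Real.add_one_le_exp h
  have h3 : Real.log h ≤ Real.exp h := (Real.log_le_sub_one_of_pos hh0).trans (by linarith)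
  have e1 : Real.exp (-(2 * h)) * (1 + 1 / h) * (h * Real.log h)
      = Real.exp (-(2 * h)) * ((h + 1) * Real.log h) := by
    field_simp
  rw [e1]
  calc _ ≤ Real.exp (-(2 * h)) * (Real.exp h * Real.exp h) := by gcongr
    _ = 1 := h1

end Kac

end KacIsing

theorem mainTheorem4 (d : ℕ) (hd : 1 ≤ d) (f : (Fin d → ℝ) → ℝ)
    (hf_nonneg : ∀ x, 0 ≤ f x) (hf_bdd : ∃ M : ℝ, ∀ x, f x ≤ M)
    (hf_riemann : KacIsing.RiemannIntegrable f) (hf_prob : ∫ x, f x = 1)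
    (β : ℝ) (hβ : 0 < β) :
    ∃ (C : ℝ) (m : ℝ → ℝ → ℝ),
      (∀ lam h : ℝ, 0 < lam → 0 < h →
        -- the finite-volume mean-field equations in boxes
        (∀ a b i : Fin d → ℤ, i ∈ Finset.Icc a b →
          |KacIsing.kacMagnetization f β lam h (Finset.Icc a b) i
              - Real.tanh (h + ∑ j ∈ Finset.Icc a b,
                  (KacIsing.kacCoupling f β lam i j + KacIsing.kacCoupling f β lam j i) / 2
                    * KacIsing.kacMagnetization f β lam h (Finset.Icc a b) j)|
            ≤ C * (lam ^ d * (1 + |Real.log h|) / h) ∧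
          (1 < h →
            |KacIsing.kacMagnetization f β lam h (Finset.Icc a b) i
                - Real.tanh (h + ∑ j ∈ Finset.Icc a b,
                    (KacIsing.kacCoupling f β lam i j + KacIsing.kacCoupling f β lam j i) / 2
                      * KacIsing.kacMagnetization f β lam h (Finset.Icc a b) j)|
              ≤ C * (lam ^ d / (h * Real.log h)))) ∧
        -- `m lam h` is the infinite-volume magnetization, the same at every site
        (∀ i : Fin d → ℤ,
          Tendsto (fun p : (Fin d → ℤ) × (Fin d → ℤ) =>
            KacIsing.kacMagnetization f β lam h (Finset.Icc p.1 p.2) i)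
            (atBot ×ˢ atTop) (𝓝 (m lam h))) ∧
        -- the infinite-volume mean-field equation
        Summable (fun i : Fin d → ℤ => lam ^ d * f (KacIsing.scaledPoint lam i)) ∧
        |m lam h - Real.tanh (h + β * m lam h *
            ∑' i : Fin d → ℤ, lam ^ d * f (KacIsing.scaledPoint lam i))|
          ≤ C * (lam ^ d * (1 + |Real.log h|) / h) ∧
        (1 < h →
          |m lam h - Real.tanh (h + β * m lam h *
              ∑' i : Fin d → ℤ, lam ^ d * f (KacIsing.scaledPoint lam i))|
            ≤ C * (lam ^ d / (h * Real.log h)))) ∧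
      -- the Curie-Weiss equation in the limit `lam → 0`
      (∀ h : ℝ, 0 < h → ∃ m₀ : ℝ,
        Tendsto (fun lam : ℝ => m lam h) (𝓝[>] 0) (𝓝 m₀) ∧
        m₀ = Real.tanh (h + β * m₀)) := by
  obtain ⟨C, hC, hbound⟩ := KacIsing.exists_meanField_bound hf_nonneg hf_bdd hf_riemann hf_prob hβ
  have hinf : ∀ lam h : ℝ, 0 < lam → 0 < h →
      |KacIsing.kacLimit f β lam h - Real.tanh (h + β * KacIsing.kacLimit f β lam h *
          ∑' i : Fin d → ℤ, lam ^ d * f (KacIsing.scaledPoint lam i))|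
        ≤ C * (lam ^ d * (Real.exp (-(2 * h)) * (1 + 1 / h))) := by
    intro lam h hlam hh
    have h1 := KacIsing.tendsto_kacMagnetization hf_nonneg hβ hlam hh 0
    have h2 := KacIsing.tendsto_sum_kacCoupling hf_nonneg hβ hlam hh
      (KacIsing.summable_scaledPoint hf_nonneg hf_riemann hlam) 0
    have h3 := (h1.sub ((KacIsing.continuous_tanh.tendsto _).comp (h2.const_add h))).abs
    -- The finite-volume bound needs the site 0 to belong to Λ, which holds eventually.
    exact le_of_tendsto h3 ((eventually_ge_atTop {0}).mono fun Λ hΛ =>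
      hbound lam h hlam hh Λ 0 (Finset.singleton_subset_iff.1 hΛ))
  have hlog : ∀ lam h : ℝ, 0 < lam → 0 < h →
      C * (lam ^ d * (Real.exp (-(2 * h)) * (1 + 1 / h)))
        ≤ C * (lam ^ d * (1 + |Real.log h|) / h) := by
    intro lam h hlam hh
    rw [mul_div_assoc]
    have := KacIsing.exp_mul_le_log_div hh
    gcongr
  have hlarge : ∀ lam h : ℝ, 0 < lam → 1 < h →
      C * (lam ^ d * (Real.exp (-(2 * h)) * (1 + 1 / h)))
        ≤ C * (lam ^ d / (h * Real.log h)) := by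
    intro lam h hlam hh
    rw [← mul_one_div (lam ^ d)]
    have := KacIsing.exp_mul_le_one_div hh
    gcongr
  refine ⟨C, KacIsing.kacLimit f β, fun lam h hlam hh => ⟨fun a b i hi => ?_, fun i => ?_, ?_, ?_,
    fun h1 => ?_⟩, fun h hh => ?_⟩
  · have h1 := hbound lam h hlam hh (Finset.Icc a b) i hi
    exact ⟨h1.trans (hlog lam h hlam hh), fun hh1 => h1.trans (hlarge lam h hlam hh1)⟩
  · exact (KacIsing.tendsto_kacMagnetization hf_nonneg hβ hlam hh i).comp
      Finset.tendsto_Icc_atBot_prod_atTop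
  · exact KacIsing.summable_scaledPoint hf_nonneg hf_riemann hlam
  · exact (hinf lam h hlam hh).trans (hlog lam h hlam hh)
  · exact (hinf lam h hlam hh).trans (hlarge lam h hlam h1)
  · refine KacIsing.tendsto_curieWeiss hβ hh (eventually_mem_nhdsWithin.mono fun lam hlam =>
      KacIsing.kacLimit_mem_Icc hf_nonneg hβ hlam hh)
      (KacIsing.tendsto_tsum_scaledPoint hf_nonneg hf_riemann hf_prob) ?_
    have hpow : Tendsto (fun lam : ℝ => C * (lam ^ d * (Real.exp (-(2 * h)) * (1 + 1 / h))))
        (𝓝[>] 0) (𝓝 0) := by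
      have hc : Continuous fun lam : ℝ =>
          C * (lam ^ d * (Real.exp (-(2 * h)) * (1 + 1 / h))) := by fun_prop
      have h0 := hc.tendsto 0
      -- The error vanishes as lam → 0 because d ≥ 1.
      rw [zero_pow (by omega), zero_mul, mul_zero] at h0
      exact h0.mono_left nhdsWithin_le_nhds
    exact squeeze_zero_norm' (eventually_mem_nhdsWithin.mono fun lam hlam =>
      hinf lam h hlam hh) hpow
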